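/- **Setting.** Let $p,d\ge 0$ be dimensions, $q\ge1$ a depth, $n\ge1$ a sample size, and $D=\{0=t_0<\dots<t_K=1\}$ a sampling grid with mesh $|D|=\max_{0\le k<K}(t_{k+1}-t_k)$. Throughout, $\|\cdot\|$ is the Euclidean norm of vectors and the Frobenius norm of matrices, and $\|\cdot\|_{\mathrm{op}}$ is the operator norm of matrices. Let $L_\sigma,L_x,B_x,B_{\mathbf A},B_{\mathbf b},B_{\mathbf U},B_v\ge 0$ and $B_\Phi>0$. Let $\sigma:\mathbb R\to\mathbb R$ be $L_\sigma$-Lipschitz with $\sigma(0)=0$, acting entrywise. *Predictors.* For parameters $\theta=(\Phi,\psi,\mathbf U,v)$ with $\Phi,v\in\mathbb R^p$, $\mathbf U\in\mathbb R^{p\times d}$, $\psi=(\mathbf A_1,\mathbf b_1,\dots,\mathbf A_q,\mathbf b_q)$, let $\mathbf G_\psi(z)=\sigma(\mathbf A_q\sigma(\cdots\sigma(\mathbf A_1z+\mathbf b_1)\cdots)+\mathbf b_q)\in\mathbb R^{p\times d}$ (the hidden layers have width $p$, the last layer has values in $\mathbb R^{p\times d}$) and $\mathrm{NN}_{\mathbf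 U,v}(u)=\sigma(\mathbf Uu+v)$. For a Lipschitz path $x:[0,1]\to\mathbb R^d$ put $f_\theta(x)=\Phi^\top z_1$, where $dz_t=\mathbf G_\psi(z_t)\,dx_t$ (Riemann–Stieltjes), $z_0=\mathrm{NN}_{\mathbf U,v}(x_0)$. For the sampled series $\mathbf x^D=(x_{t_0},\dots,x_{t_K})$ put $f_\theta(\mathbf x^D)=\Phi^\top z^D_K$, where $z^D_0=\mathrm{NN}_{\mathbf U,v}(x_0)$ and $z^D_k=z^D_{k-1}+\mathbf G_\psi(z^D_{k-1})(x_{t_k}-x_{t_{k-1}})$. Let $\Theta$ be the set of $\theta$ with $\|\Phi\|\le B_\Phi$, $\|\mathbf A_h\|\le B_{\mathbf A}$, $\|\mathbf b_h\|\le B_{\mathbf b}$ for all $h$, $\|\mathbf U\|\le B_{\mathbf U}$, $\|v\|\le B_v$, and let $\mathcal F_\Theta$, $\mathcal F_\Theta^D$ be the classes of the maps $x\mapsto f_\theta(x)$, resp. $\mathbf x^D\mapsto f_\theta(\mathbf x^D)$, $\theta\in\Theta$. *Model and data.* Almost surely the random path $x$ is $L_x$-Lipschitz with $\|x_0\|\le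 B_x$, and $y=\mathbf f^\star(x)+\varepsilon$, where $|\varepsilon|\le M_\varepsilon$, $\mathbf f^\star(x)=\Phi_\star^\top z^\star_1$ and $dz^\star_t=\mathbf G^\star(z^\star_t)\,dx_t$, $z^\star_0=\varphi^\star(x_0)$. Here $\mathbf G^\star:\mathbb R^p\to\mathbb R^{p\times d}$ is $L_{\mathbf G^\star}$-Lipschitz, $\varphi^\star:\mathbb R^d\to\mathbb R^p$ is continuous and $\|\Phi_\star\|\le B_\Phi$. The pairs $(x^i,y^i)$, $i=1,\dots,n$, are i.i.d. copies of $(x,y)$. *Loss and risks.* Let $\mathcal Y\subset\mathbb R$ be a set that contains the outcome $y$ (a.s.) and the values of $\mathbf f^\star$ and of all predictors, with continuous or sampled input, on all $L_x$-Lipschitz paths that start in the ball of radius $B_x$. The loss $\ell:\mathbb R\times\mathbb R\to\mathbb R_+$ is measurable, bounded on $\mathcal Y\times\mathcal Y$, and satisfies $|\ell(y,u)-\ell(y,u')|\le L_\ell|u-u'|$ for $y,u,u'\in\mathcal Y$. Let $\mathcal R(f)=\mathbb E[\ell(y,f(x))]$, $\mathcal R^D(f)=\mathbb E[\ell(y,f(\mathbf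 x^D))]$ (for a predictor that depends on the sample, $(x,y)$ is a fresh pair), and let $\hat f^D\in\mathcal F_\Theta^D$ minimize the empirical risk $\frac1n\sum_i\ell(y^i,f(\mathbf x^{D,i}))$ over $\mathcal F^D_\Theta$. For a class $\mathcal F$, $\mathrm{Rad}(\mathcal F)=\mathbb E\big[\sup_{f\in\mathcal F}\frac1n\sum_{i}s_if(\xi^i)\big]$ is its Rademacher complexity, with independent uniform signs $s_i$, $\xi^i=x^i$ for $\mathcal F_\Theta$ and $\xi^i=\mathbf x^{D,i}$ for $\mathcal F_\Theta^D$; the expectation is over the signs and the sample. *Constants.* Let $$\kappa_\Theta(\mathbf 0)=L_\sigma B_{\mathbf b}\sum_{j=0}^{q-1}(L_\sigma B_{\mathbf A})^j,\qquad M_\Theta=B_\Phi L_\sigma\, e^{(L_\sigma B_{\mathbf A})^qL_x}\big(B_{\mathbf U}B_x+B_v+\kappa_\Theta(\mathbf 0)L_x\big),$$ $$M^D_\Theta=B_\Phi L_\sigma\big(1+(L_\sigma B_{\mathbf A})^qL_x|D|\big)^K\big(B_{\mathbf U}B_x+B_v+\kappa_\Theta(\mathbf 0)L_x\big),$$ $$\Omega=\Big\{u\in\mathbb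 R^p:\ \|u\|\le\big(L_\sigma(B_{\mathbf U}B_x+B_v)+\kappa_\Theta(\mathbf 0)L_x\big)e^{(L_\sigma B_{\mathbf A})^qL_x}\Big\}.$$ **Theorem.** The expectation over the sample of the total risk satisfies $$\begin{aligned}\mathbb E\big[\mathcal R^D(\hat f^D)\big]-\mathcal R(\mathbf f^\star)\ \le\ & 4L_\ell\max\{\mathrm{Rad}(\mathcal F_\Theta),\mathrm{Rad}(\mathcal F^D_\Theta)\}\\ &+L_\ell B_\Phi\, e^{(L_\sigma B_{\mathbf A})^qL_x}L_x\Big[1+(L_\sigma B_{\mathbf A})^q\Big((L_\sigma B_{\mathbf A})^q\tfrac{\min\{M_\Theta^D,M_\Theta\}}{B_\Phi}+\kappa_\Theta(\mathbf 0)\Big)L_x\Big]|D|\\ &+L_\ell B_\Phi\, e^{L_{\mathbf G^\star}L_x}\Big[L_x\min_{\psi}\max_{u\in\Omega}\|\mathbf G_\psi(u)-\mathbf G^\star(u)\|_{\mathrm{op}}+\min_{\mathbf U,v}\max_{\|u\|\le B_x}\|\varphi^\star(u)-\mathrm{NN}_{\mathbf U,v}(u)\|\Big],\end{aligned}$$ where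 the minima are over the parameters admitted by $\Theta$. -/

import Mathlib

open MeasureTheory ProbabilityTheory

attribute [local instance] Matrix.frobeniusNormedAddCommGroup

namespace NCDE

/-- Euclidean space of dimension `m`. -/
abbrev Vec (m : ℕ) : Type := EuclideanSpace ℝ (Fin m)

/-- Paths on the unit interval with values in Euclidean space, with the product sigma-algebra. -/
abbrev DrivingPath (d : ℕ) : Type := unitInterval → Vec d

/-- Time series with `K + 1` observations. -/
abbrev Series (d K : ℕ) : Type := Fin (K + 1) → Vec d

/-- The matrix-vector product between Euclidean spaces. -/
noncomputable def app {m k : ℕ} (M : Matrix (Fin m) (Fin k) ℝ) (u : Vec k) : Vec m :=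
  Matrix.toEuclideanLin M u

/-- The operator norm of a matrix for the Euclidean norms. (The notation `‖M‖` for a matrix is
the Frobenius norm.) -/
noncomputable def opNorm {m k : ℕ} (M : Matrix (Fin m) (Fin k) ℝ) : ℝ :=
  ‖LinearMap.toContinuousLinearMap (Matrix.toEuclideanLin M)‖

/-! ### Riemann-Stieltjes integrals and controlled differential equations -/

/-- `J` is the Riemann-Stieltjes integral of the matrix-valued function `f` against the path `g`
over `[a, b]`: the limit of the tagged Riemann-Stieltjes sums as the mesh tends to zero. -/
def HasRSIntegral {p d : ℕ} (f : unitInterval → Matrix (Fin p) (Fin d) ℝ) (g : DrivingPath d)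
    (a b : unitInterval) (J : Vec p) : Prop :=
  ∀ η : ℝ, 0 < η → ∃ δ : ℝ, 0 < δ ∧
    ∀ (N : ℕ) (t : Fin (N + 1) → unitInterval) (s : Fin N → unitInterval),
      Monotone t → t 0 = a → t (Fin.last N) = b →
      (∀ k : Fin N, t k.castSucc ≤ s k ∧ s k ≤ t k.succ) →
      (∀ k : Fin N, (t k.succ : ℝ) - (t k.castSucc : ℝ) < δ) →
      ‖(∑ k : Fin N, app (f (s k)) (g (t k.succ) - g (t k.castSucc))) - J‖ < η

/-- `z` solves `dz = G(z) dx`, `z_0 = z₀` on the unit interval, for a continuous driving path `x`. -/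
def IsCDESolution {p d : ℕ} (G : Vec p → Matrix (Fin p) (Fin d) ℝ) (z₀ : Vec p) (x : DrivingPath d)
    (z : unitInterval → Vec p) : Prop :=
  Continuous z ∧ z 0 = z₀ ∧ ∀ t : unitInterval, HasRSIntegral (fun s => G (z s)) x 0 t (z t - z₀)

open Classical in
/-- The value at time `1` of the solution of `dz = G(z) dx`, `z_0 = z₀` (zero if there is no
solution, which does not happen for a Lipschitz vector field and a Lipschitz path). -/
noncomputable def cdeTerminal {p d : ℕ} (G : Vec p → Matrix (Fin p) (Fin d) ℝ) (z₀ : Vec p)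
    (x : DrivingPath d) : Vec p :=
  if h : ∃ z : unitInterval → Vec p, IsCDESolution G z₀ x z then h.choose 1 else 0

/-- The terminal value of the recursion `z_k = z_{k-1} + G(z_{k-1}) (x_k - x_{k-1})`, that is, of
the solution of the CDE driven by the fill-forward embedding of the time series. -/
noncomputable def resnetTerminal {p d K : ℕ} (G : Vec p → Matrix (Fin p) (Fin d) ℝ) (z₀ : Vec p)
    (x : Series d K) : Vec p :=
  Fin.foldl K (fun z k => z + app (G z) (x k.succ - x k.castSucc)) z₀

/-! ### Neural vector fields, neural CDEs and controlled ResNets -/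

/-- Entrywise application of the activation function. -/
noncomputable def act (σ : ℝ → ℝ) {m : ℕ} (u : Vec m) : Vec m :=
  WithLp.toLp 2 (fun i => σ (u i))

/-- Parameters of a feed-forward vector field with `q ≥ 1` layers: `q - 1` layers of width `p`
and one last layer with values in the `p × d` matrices. -/
structure VFParams (p d q : ℕ) where
  A : Fin (q - 1) → Matrix (Fin p) (Fin p) ℝ
  b : Fin (q - 1) → Vec p
  Alast : Matrix (Fin p × Fin d) (Fin p) ℝ
  blast : Matrix (Fin p) (Fin d) ℝ

/-- The neural vector field `σ(A_q σ(A_{q-1} σ(… σ(A_1 z + b_1)) + b_{q-1}) + b_q)`. -/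
noncomputable def neuralVF {p d q : ℕ} (σ : ℝ → ℝ) (ψ : VFParams p d q) (z : Vec p) :
    Matrix (Fin p) (Fin d) ℝ :=
  let w : Vec p := Fin.foldl (q - 1) (fun u h => act σ (app (ψ.A h) u + ψ.b h)) z
  Matrix.of fun i j => σ ((∑ k, ψ.Alast (i, j) k * w k) + ψ.blast i j)

/-- The initialization network `u ↦ σ(U u + v)`. -/
noncomputable def initNN {p d : ℕ} (σ : ℝ → ℝ) (U : Matrix (Fin p) (Fin d) ℝ) (v : Vec p)
    (u : Vec d) : Vec p :=
  act σ (app U u + v)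

/-- The parameters `θ = (Φ, ψ, U, v)` of a neural CDE. -/
structure Params (p d q : ℕ) where
  Φ : Vec p
  ψ : VFParams p d q
  U : Matrix (Fin p) (Fin d) ℝ
  v : Vec p

/-- The prediction `Φᵀ z_1` for a vector field `G` and an initial map `φ`. -/
noncomputable def cdePredictor {p d : ℕ} (Φ : Vec p) (G : Vec p → Matrix (Fin p) (Fin d) ℝ)
    (φ : Vec d → Vec p) (x : DrivingPath d) : ℝ :=
  inner ℝ Φ (cdeTerminal G (φ (x 0)) x)

/-- The neural CDE `f_θ` on paths. -/
noncomputable def ncde {p d q : ℕ} (σ : ℝ → ℝ) (θ : Params p d q) (x : DrivingPath d) : ℝ :=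
  cdePredictor θ.Φ (neuralVF σ θ.ψ) (initNN σ θ.U θ.v) x

/-- The controlled ResNet `f_θ` on time series. -/
noncomputable def ncdeD {p d q K : ℕ} (σ : ℝ → ℝ) (θ : Params p d q) (x : Series d K) : ℝ :=
  inner ℝ θ.Φ (resnetTerminal (neuralVF σ θ.ψ) (initNN σ θ.U θ.v (x 0)) x)

/-- The constants of the model: the Lipschitz constant of the activation function, the Lipschitz
constant of the paths, the bound on their initial value, and the bounds on the parameters. -/
structure Consts where
  Lσ : ℝ
  Lx : ℝ
  Bx : ℝ
  BΦ : ℝ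
  BA : ℝ
  Bb : ℝ
  BU : ℝ
  Bv : ℝ

/-- The admissible parameters of the vector field. -/
def psiSet (p d q : ℕ) (c : Consts) : Set (VFParams p d q) :=
  {ψ | (∀ h, ‖ψ.A h‖ ≤ c.BA) ∧ (∀ h, ‖ψ.b h‖ ≤ c.Bb) ∧ ‖ψ.Alast‖ ≤ c.BA ∧ ‖ψ.blast‖ ≤ c.Bb}

/-- The admissible parameters of the initialization network. -/
def initSet (p d : ℕ) (c : Consts) : Set (Matrix (Fin p) (Fin d) ℝ × Vec p) :=
  {ξ | ‖ξ.1‖ ≤ c.BU ∧ ‖ξ.2‖ ≤ c.Bv}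

/-- The parameter set `Θ`. -/
def thetaSet (p d q : ℕ) (c : Consts) : Set (Params p d q) :=
  {θ | ‖θ.Φ‖ ≤ c.BΦ ∧ θ.ψ ∈ psiSet p d q c ∧ (θ.U, θ.v) ∈ initSet p d c}

/-- The class `F_Θ` of neural CDEs. -/
def classF (p d q : ℕ) (σ : ℝ → ℝ) (c : Consts) : Set (DrivingPath d → ℝ) :=
  ncde σ '' thetaSet p d q c

/-- The class `F_Θ^D` of controlled ResNets. -/
def classFD (p d q K : ℕ) (σ : ℝ → ℝ) (c : Consts) : Set (Series d K → ℝ) :=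
  ncdeD σ '' thetaSet p d q c

/-- `L_x`-Lipschitz paths with initial value in the ball of radius `B_x`. -/
def Admissible {d : ℕ} (c : Consts) (x : DrivingPath d) : Prop :=
  (∀ s t : unitInterval, ‖x s - x t‖ ≤ c.Lx * |(s : ℝ) - (t : ℝ)|) ∧ ‖x 0‖ ≤ c.Bx

/-- Sampling grids `0 = t_0 < ⋯ < t_K = 1`. -/
def IsGrid {K : ℕ} (D : Fin (K + 1) → unitInterval) : Prop :=
  StrictMono D ∧ D 0 = 0 ∧ D (Fin.last K) = 1

/-- The time series obtained by sampling a path on a grid. -/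
def sampleOn {d K : ℕ} (D : Fin (K + 1) → unitInterval) (x : DrivingPath d) : Series d K :=
  fun k => x (D k)

/-- The greatest gap between two consecutive sampling times. -/
noncomputable def mesh {K : ℕ} (D : Fin (K + 1) → unitInterval) : ℝ :=
  ⨆ k : Fin K, ((D k.succ : ℝ) - (D k.castSucc : ℝ))

/-! ### Constants of the bound -/

/-- `(L_σ B_A)^q`. -/
noncomputable def Consts.LG (c : Consts) (q : ℕ) : ℝ := (c.Lσ * c.BA) ^ q

/-- `κ_Θ(0) = L_σ B_b ((L_σ B_A)^q - 1) / (L_σ B_A - 1)`, written as a geometric sum. -/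
noncomputable def Consts.kappa (c : Consts) (q : ℕ) : ℝ :=
  c.Lσ * c.Bb * ∑ j ∈ Finset.range q, (c.Lσ * c.BA) ^ j

/-- The constant `M_Θ`. -/
noncomputable def Consts.M (c : Consts) (q : ℕ) : ℝ :=
  c.BΦ * c.Lσ * Real.exp (c.LG q * c.Lx) * (c.BU * c.Bx + c.Bv + c.kappa q * c.Lx)

/-- The constant `M_Θ^D`. -/
noncomputable def Consts.MD (c : Consts) (q : ℕ) {K : ℕ} (D : Fin (K + 1) → unitInterval) : ℝ :=
  c.BΦ * c.Lσ * (1 + c.LG q * c.Lx * mesh D) ^ K * (c.BU * c.Bx + c.Bv + c.kappa q * c.Lx)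

/-- The radius of the ball `Ω` in which the latent trajectories of the neural CDEs stay. -/
noncomputable def Consts.radius (c : Consts) (q : ℕ) : ℝ :=
  (c.Lσ * (c.BU * c.Bx + c.Bv) + c.kappa q * c.Lx) * Real.exp (c.LG q * c.Lx)

/-! ### Risks and Rademacher complexity -/

/-- The expected risk of `f` for the random input `ξ` and the random outcome `y`. -/
noncomputable def risk {𝓧 W : Type*} [MeasurableSpace W] (P : Measure W) (ℓ : ℝ → ℝ → ℝ)
    (ξ : W → 𝓧) (y : W → ℝ) (f : 𝓧 → ℝ) : ℝ :=
  ∫ ω, ℓ (y ω) (f (ξ ω)) ∂P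

/-- The empirical risk of `f` on a sample. -/
noncomputable def empRisk {𝓧 : Type*} {n : ℕ} (ℓ : ℝ → ℝ → ℝ) (ξ : Fin n → 𝓧) (y : Fin n → ℝ)
    (f : 𝓧 → ℝ) : ℝ :=
  (1 / (n : ℝ)) * ∑ i, ℓ (y i) (f (ξ i))

/-- `f` minimizes the empirical risk over the class `F`. -/
def IsERM {𝓧 : Type*} {n : ℕ} (F : Set (𝓧 → ℝ)) (ℓ : ℝ → ℝ → ℝ) (ξ : Fin n → 𝓧)
    (y : Fin n → ℝ) (f : 𝓧 → ℝ) : Prop :=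
  f ∈ F ∧ ∀ g ∈ F, empRisk ℓ ξ y f ≤ empRisk ℓ ξ y g

/-- The empirical Rademacher complexity of a class of functions on a sample: the mean over
independent uniform signs of `sup_{f ∈ F} (1/n) ∑ ± f(ξ_i)`. -/
noncomputable def empRademacher {𝓧 : Type*} {n : ℕ} (F : Set (𝓧 → ℝ)) (ξ : Fin n → 𝓧) : ℝ :=
  (1 / (2 : ℝ) ^ n) * ∑ s : Fin n → Bool,
    ⨆ f : F, (1 / (n : ℝ)) * ∑ i, (if s i then (1 : ℝ) else -1) * (f : 𝓧 → ℝ) (ξ i)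

/-- The Rademacher complexity: the expectation of the empirical one over the sample. -/
noncomputable def rademacher {𝓧 W : Type*} [MeasurableSpace W] {n : ℕ} (P : Measure W)
    (F : Set (𝓧 → ℝ)) (ξ : Fin n → W → 𝓧) : ℝ :=
  ∫ ω, empRademacher F (fun i => ξ i ω) ∂P

end NCDE

open NCDE

/-! Take any admissible `ψ` and `(U, v)` and complete them with the true readout `Φstar`; the result
`θ` lies in `Θ` because `‖Φstar‖ ≤ BΦ`. The excess risk then splits into an estimation term, the
expected risk of the minimizer minus the risk of `f_θ` on sampled inputs, and a bias term, the risk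
of `f_θ` on sampled inputs minus the risk of the target.

Estimation (`integral_risk_le_of_isERM`). The minimizer has empirical risk at most that of `f_θ`,
and for the fixed `θ` the empirical risk has mean equal to the risk. Only the one-sided uniform
deviation of the minimizer remains. Symmetrization (`integral_ciSup_sub_le`) and contraction
(`empRademacher_range_le_mul`) bound its mean by `2 Lℓ` times the complexity of the sampled class.
The factor 4 and the maximum with the continuous class are slack. Suprema over the class are
replaced by suprema over a pointwise dense sequence, which makes them measurable.

Bias (`abs_ncdeD_sub_cdePredictor_le`). The loss is Lipschitz, so it suffices to compare the ResNet
with the target pathwise, through the solution `z` of the neural CDE with the same parameters. From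
ResNet to `z` the error is that of an Euler scheme (`IsCDESolution.norm_sub_resnetTerminal_le`), of
order `mesh D`. From `z` to the target it is a perturbation of vector field and initial value
(`IsCDESolution.norm_sub_of_opNorm_le` in spirit: the fields are compared along `z` only, which
stays in `Ω`).

The analysis of CDEs rests on one property: over `[s, t]` a solution differs from an Euler step by
`O((t - s)²)`. Every solution has it, and every curve of Lipschitz type that has it is a solution. A
Gronwall inequality insensitive to quadratic errors turns it into all the global bounds, and it
survives limits of Euler schemes, which gives existence.

Finally `ψ` and `(U, v)` are taken within `η` of the infima and `η` tends to zero, so attainment of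
the minima is not needed. -/

namespace NCDE

/-! ### Matrices -/

section Matrices

variable {m k : ℕ}

theorem app_apply (M : Matrix (Fin m) (Fin k) ℝ) (u : Vec k) (i : Fin m) :
    app M u i = ∑ j, M i j * u j := by
  simp [app, Matrix.toLpLin_apply, Matrix.mulVec, dotProduct]

theorem app_sub_right (M : Matrix (Fin m) (Fin k) ℝ) (u v : Vec k) :
    app M (u - v) = app M u - app M v := by simp [app]

theorem app_sub_left (M N : Matrix (Fin m) (Fin k) ℝ) (u : Vec k) :
    app (M - N) u = app M u - app N u := by simp [app]

theorem app_zero_left (u : Vec k) : app (0 : Matrix (Fin m) (Fin k) ℝ) u = 0 := by simp [app]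

theorem app_zero_right (M : Matrix (Fin m) (Fin k) ℝ) : app M 0 = 0 := by simp [app]

theorem continuous_app (M : Matrix (Fin m) (Fin k) ℝ) : Continuous (app M) :=
  (LinearMap.toContinuousLinearMap (Matrix.toEuclideanLin M)).continuous

theorem opNorm_nonneg (M : Matrix (Fin m) (Fin k) ℝ) : 0 ≤ opNorm M := norm_nonneg _

theorem norm_app_le_opNorm (M : Matrix (Fin m) (Fin k) ℝ) (u : Vec k) :
    ‖app M u‖ ≤ opNorm M * ‖u‖ :=
  (LinearMap.toContinuousLinearMap (Matrix.toEuclideanLin M)).le_opNorm u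

theorem frobenius_norm_sq {ι κ : Type*} [Fintype ι] [Fintype κ] (M : Matrix ι κ ℝ) :
    ‖M‖ ^ 2 = ∑ i, ∑ j, M i j ^ 2 := by
  rw [Matrix.frobenius_norm_def, ← Real.sqrt_eq_rpow, Real.sq_sqrt]
  · simp
  · positivity

theorem norm_vec_sq (u : Vec k) : ‖u‖ ^ 2 = ∑ i, u i ^ 2 := by
  rw [EuclideanSpace.norm_eq, Real.sq_sqrt (by positivity)]; simp

/-- The Frobenius norm bounds the Euclidean operator norm, for any finite set of rows. -/
theorem sum_sq_mul_le {ι : Type*} [Fintype ι] (M : Matrix ι (Fin k) ℝ) (u : Vec k) :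
    ∑ i, (∑ j, M i j * u j) ^ 2 ≤ (‖M‖ * ‖u‖) ^ 2 := by
  rw [mul_pow, frobenius_norm_sq, norm_vec_sq, Finset.sum_mul]
  exact Finset.sum_le_sum fun i _ => Finset.sum_mul_sq_le_sq_mul_sq _ _ _

theorem norm_app_le (M : Matrix (Fin m) (Fin k) ℝ) (u : Vec k) : ‖app M u‖ ≤ ‖M‖ * ‖u‖ := by
  refine le_of_sq_le_sq ?_ (by positivity)
  rw [norm_vec_sq]
  simpa only [app_apply] using sum_sq_mul_le M u

theorem opNorm_le_norm (M : Matrix (Fin m) (Fin k) ℝ) : opNorm M ≤ ‖M‖ :=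
  ContinuousLinearMap.opNorm_le_bound _ (norm_nonneg _) (norm_app_le M)

theorem opNorm_sub_le (M N : Matrix (Fin m) (Fin k) ℝ) : opNorm (M - N) ≤ opNorm M + opNorm N := by
  simp only [opNorm, map_sub]
  exact norm_sub_le _ _

end Matrices

/-! ### Neural vector fields -/

section NeuralVF

variable {σ : ℝ → ℝ} {L : ℝ}

theorem norm_act_sub_le (hL : 0 ≤ L) (hσ : ∀ u v : ℝ, |σ u - σ v| ≤ L * |u - v|) {m : ℕ}
    (u v : Vec m) : ‖act σ u - act σ v‖ ≤ L * ‖u - v‖ := by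
  refine le_of_sq_le_sq ?_ (by positivity)
  rw [norm_vec_sq, mul_pow, norm_vec_sq, Finset.mul_sum]
  refine Finset.sum_le_sum fun i _ => ?_
  rw [← sq_abs, ← sq_abs ((u - v) i), ← mul_pow]
  exact pow_le_pow_left₀ (abs_nonneg _) (hσ (u i) (v i)) 2

theorem act_zero (hσ0 : σ 0 = 0) {m : ℕ} : act σ (0 : Vec m) = 0 := by
  ext i; simp [act, hσ0]

theorem norm_act_le (hL : 0 ≤ L) (hσ : ∀ u v : ℝ, |σ u - σ v| ≤ L * |u - v|) (hσ0 : σ 0 = 0)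
    {m : ℕ} (u : Vec m) : ‖act σ u‖ ≤ L * ‖u‖ := by
  simpa [act_zero hσ0] using norm_act_sub_le hL hσ u 0

/-- An invariant of a fold over `Fin n` that holds for the initial value and is preserved at each
step holds for the result. -/
theorem foldl_invariant {α : Type*} {n : ℕ} (f : α → Fin n → α) (a : α) (C : Fin (n + 1) → α → Prop)
    (h0 : C 0 a) (hs : ∀ (i : Fin n) (b : α), C i.castSucc b → C i.succ (f b i)) :
    C (Fin.last n) (Fin.foldl n f a) := by
  induction n with
  | zero => simpa using h0
  | succ n ih =>
    rw [Fin.foldl_succ_last]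
    refine hs (Fin.last n) _ ?_
    exact ih (fun b i => f b i.castSucc) (fun i b => C i.castSucc b) (by simpa using h0)
      (fun i b hb => by simpa using hs i.castSucc b hb)

/-- Two folds over `Fin n` stay related if each step preserves the relation. -/
theorem foldl_invariant₂ {α β : Type*} {n : ℕ} (f : α → Fin n → α) (g : β → Fin n → β) (a : α)
    (b : β) (C : Fin (n + 1) → α → β → Prop) (h0 : C 0 a b)
    (hs : ∀ (i : Fin n) (a : α) (b : β), C i.castSucc a b → C i.succ (f a i) (g b i)) :
    C (Fin.last n) (Fin.foldl n f a) (Fin.foldl n g b) := by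
  induction n with
  | zero => simpa using h0
  | succ n ih =>
    rw [Fin.foldl_succ_last, Fin.foldl_succ_last]
    refine hs (Fin.last n) _ _ ?_
    exact ih (fun b i => f b i.castSucc) (fun b i => g b i.castSucc)
      (fun i a b => C i.castSucc a b) (by simpa using h0)
      (fun i a b hb => by simpa using hs i.castSucc a b hb)

variable {p d q : ℕ}

/-- The output of the hidden layers. -/
noncomputable def hidden (σ : ℝ → ℝ) (ψ : VFParams p d q) (z : Vec p) : Vec p :=
  Fin.foldl (q - 1) (fun u h => act σ (app (ψ.A h) u + ψ.b h)) z

theorem neuralVF_apply (σ : ℝ → ℝ) (ψ : VFParams p d q) (z : Vec p) (i : Fin p) (j : Fin d) :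
    neuralVF σ ψ z i j = σ ((∑ k, ψ.Alast (i, j) k * hidden σ ψ z k) + ψ.blast i j) := rfl

variable {c : Consts}

/-- The biases cancel in differences, so each hidden layer contributes one factor `Lσ * BA`. -/
theorem norm_hidden_sub_le (hL : 0 ≤ c.Lσ) (hBA : 0 ≤ c.BA)
    (hσ : ∀ u v : ℝ, |σ u - σ v| ≤ c.Lσ * |u - v|) {ψ : VFParams p d q} (hψ : ψ ∈ psiSet p d q c)
    (z w : Vec p) : ‖hidden σ ψ z - hidden σ ψ w‖ ≤ (c.Lσ * c.BA) ^ (q - 1) * ‖z - w‖ := by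
  have := foldl_invariant₂ (fun u h => act σ (app (ψ.A h) u + ψ.b h))
    (fun u h => act σ (app (ψ.A h) u + ψ.b h)) z w
    (fun i u v => ‖u - v‖ ≤ (c.Lσ * c.BA) ^ (i : ℕ) * ‖z - w‖) (by simp) ?_
  · simpa [hidden] using this
  intro i u v huv
  calc _ ≤ c.Lσ * ‖(app (ψ.A i) u + ψ.b i) - (app (ψ.A i) v + ψ.b i)‖ := norm_act_sub_le hL hσ _ _
    _ = c.Lσ * ‖app (ψ.A i) (u - v)‖ := by rw [app_sub_right]; congr 2; abel
    _ ≤ c.Lσ * (c.BA * ‖u - v‖) := by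
      gcongr
      exact (norm_app_le _ _).trans (by gcongr; exact hψ.1 i)
    _ ≤ c.Lσ * (c.BA * ((c.Lσ * c.BA) ^ (i : ℕ) * ‖z - w‖)) := by gcongr; simpa using huv
    _ = _ := by simp only [Fin.val_succ]; ring

/-- Layer by layer the bound follows the recursion `r ↦ Lσ * (BA * r + Bb)` from `0`, whose iterates
are the partial geometric sums. -/
theorem norm_hidden_zero_le (hL : 0 ≤ c.Lσ) (hBA : 0 ≤ c.BA)
    (hσ : ∀ u v : ℝ, |σ u - σ v| ≤ c.Lσ * |u - v|) (hσ0 : σ 0 = 0) {ψ : VFParams p d q}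
    (hψ : ψ ∈ psiSet p d q c) :
    ‖hidden σ ψ 0‖ ≤ c.Lσ * c.Bb * ∑ j ∈ Finset.range (q - 1), (c.Lσ * c.BA) ^ j := by
  have := foldl_invariant (fun u h => act σ (app (ψ.A h) u + ψ.b h)) 0
    (fun i u => ‖u‖ ≤ c.Lσ * c.Bb * ∑ j ∈ Finset.range (i : ℕ), (c.Lσ * c.BA) ^ j) (by simp) ?_
  · simpa [hidden] using this
  intro i u hu
  calc _ ≤ c.Lσ * ‖app (ψ.A i) u + ψ.b i‖ := norm_act_le hL hσ hσ0 _
    _ ≤ c.Lσ * (c.BA * (c.Lσ * c.Bb * ∑ j ∈ Finset.range (i : ℕ), (c.Lσ * c.BA) ^ j) + c.Bb) := by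
      gcongr
      refine (norm_add_le _ _).trans (add_le_add ((norm_app_le _ _).trans ?_) (hψ.2.1 i))
      gcongr
      · exact hψ.1 i
      · simpa using hu
    _ = _ := by
      simp only [Fin.val_succ, Finset.sum_range_succ', pow_succ, ← Finset.sum_mul]; ring

/-- The Frobenius norm of the output is the Euclidean norm of a vector indexed by pairs, so the last
layer is one more factor `Lσ * BA`. Since `q - 1` is truncated and the last layer is always present,
the exponent `q` is right only for `1 ≤ q`. -/
theorem norm_neuralVF_sub_le (hq : 1 ≤ q) (hL : 0 ≤ c.Lσ) (hBA : 0 ≤ c.BA)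
    (hσ : ∀ u v : ℝ, |σ u - σ v| ≤ c.Lσ * |u - v|) {ψ : VFParams p d q} (hψ : ψ ∈ psiSet p d q c)
    (z w : Vec p) : ‖neuralVF σ ψ z - neuralVF σ ψ w‖ ≤ c.LG q * ‖z - w‖ := by
  have key : ‖neuralVF σ ψ z - neuralVF σ ψ w‖
      ≤ c.Lσ * (‖ψ.Alast‖ * ‖hidden σ ψ z - hidden σ ψ w‖) := by
    refine le_of_sq_le_sq ?_ (by positivity)
    have h := mul_le_mul_of_nonneg_left (sum_sq_mul_le ψ.Alast (hidden σ ψ z - hidden σ ψ w))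
      (sq_nonneg c.Lσ)
    rw [mul_pow]
    refine le_trans ?_ h
    rw [frobenius_norm_sq, ← Fintype.sum_prod_type', Finset.mul_sum]
    refine Finset.sum_le_sum fun ij _ => ?_
    rw [← mul_pow, ← sq_abs, ← sq_abs (c.Lσ * _), abs_mul, abs_of_nonneg hL]
    refine pow_le_pow_left₀ (abs_nonneg _) ?_ 2
    rw [Matrix.sub_apply, neuralVF_apply, neuralVF_apply]
    refine (hσ _ _).trans (le_of_eq ?_)
    congr 2
    simp only [PiLp.sub_apply, mul_sub, Finset.sum_sub_distrib]
    ring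
  refine key.trans ?_
  calc _ ≤ c.Lσ * (c.BA * ((c.Lσ * c.BA) ^ (q - 1) * ‖z - w‖)) := by
        gcongr
        · exact hψ.2.2.1
        · exact norm_hidden_sub_le hL hBA hσ hψ z w
    _ = _ := by
      obtain ⟨r, rfl⟩ := Nat.exists_eq_add_of_le' hq
      simp only [Consts.LG, Nat.add_sub_cancel, pow_succ]; ring

theorem norm_neuralVF_zero_le (hq : 1 ≤ q) (hL : 0 ≤ c.Lσ) (hBA : 0 ≤ c.BA)
    (hσ : ∀ u v : ℝ, |σ u - σ v| ≤ c.Lσ * |u - v|) (hσ0 : σ 0 = 0) {ψ : VFParams p d q}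
    (hψ : ψ ∈ psiSet p d q c) : ‖neuralVF σ ψ 0‖ ≤ c.kappa q := by
  set N : Matrix (Fin p) (Fin d) ℝ := Matrix.of fun i j => ∑ k, ψ.Alast (i, j) k * hidden σ ψ 0 k
  have hN : ‖N‖ ≤ ‖ψ.Alast‖ * ‖hidden σ ψ 0‖ := by
    refine le_of_sq_le_sq ?_ (by positivity)
    refine le_trans ?_ (sum_sq_mul_le ψ.Alast (hidden σ ψ 0))
    rw [frobenius_norm_sq, ← Fintype.sum_prod_type']
    rfl
  have key : ‖neuralVF σ ψ 0‖ ≤ c.Lσ * ‖N + ψ.blast‖ := by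
    refine le_of_sq_le_sq ?_ (by positivity)
    rw [frobenius_norm_sq, mul_pow, frobenius_norm_sq, Finset.mul_sum]
    refine Finset.sum_le_sum fun i _ => ?_
    rw [Finset.mul_sum]
    refine Finset.sum_le_sum fun j _ => ?_
    rw [← mul_pow, ← sq_abs, ← sq_abs (c.Lσ * _), abs_mul, abs_of_nonneg hL]
    refine pow_le_pow_left₀ (abs_nonneg _) ?_ 2
    simpa [hσ0, neuralVF_apply, N] using
      hσ ((∑ k, ψ.Alast (i, j) k * hidden σ ψ 0 k) + ψ.blast i j) 0
  refine key.trans ?_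
  calc _ ≤ c.Lσ * (c.BA * (c.Lσ * c.Bb * ∑ j ∈ Finset.range (q - 1), (c.Lσ * c.BA) ^ j) + c.Bb) := by
        gcongr
        refine (norm_add_le _ _).trans (add_le_add (hN.trans ?_) hψ.2.2.2)
        gcongr
        · exact hψ.2.2.1
        · exact norm_hidden_zero_le hL hBA hσ hσ0 hψ
    _ = _ := by
      obtain ⟨r, rfl⟩ := Nat.exists_eq_add_of_le' hq
      simp only [Consts.kappa, Nat.add_sub_cancel, Finset.sum_range_succ' _ r, pow_succ,
        ← Finset.sum_mul]
      ring

theorem norm_initNN_le (hL : 0 ≤ c.Lσ) (hBU : 0 ≤ c.BU)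
    (hσ : ∀ u v : ℝ, |σ u - σ v| ≤ c.Lσ * |u - v|) (hσ0 : σ 0 = 0)
    {U : Matrix (Fin p) (Fin d) ℝ} {v : Vec p} (h : (U, v) ∈ initSet p d c) {u : Vec d}
    (hu : ‖u‖ ≤ c.Bx) : ‖initNN σ U v u‖ ≤ c.Lσ * (c.BU * c.Bx + c.Bv) := by
  refine (norm_act_le hL hσ hσ0 _).trans ?_
  gcongr
  refine (norm_add_le _ _).trans (add_le_add ((norm_app_le _ _).trans ?_) h.2)
  gcongr
  exact h.1

theorem continuous_act (hL : 0 ≤ L) (hσ : ∀ u v : ℝ, |σ u - σ v| ≤ L * |u - v|) {m : ℕ} :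
    Continuous (act σ : Vec m → Vec m) :=
  (LipschitzWith.of_dist_le_mul (K := NNReal.mk L hL) fun u v => by
    rw [dist_eq_norm, dist_eq_norm]
    exact norm_act_sub_le hL hσ u v).continuous

theorem continuous_initNN (hL : 0 ≤ L) (hσ : ∀ u v : ℝ, |σ u - σ v| ≤ L * |u - v|)
    (U : Matrix (Fin p) (Fin d) ℝ) (v : Vec p) : Continuous (initNN σ U v) :=
  (continuous_act hL hσ).comp ((continuous_app U).add continuous_const)

end NeuralVF

open Filter Topology

/-! ### Controlled differential equations -/

theorem sum_succ_sub_castSucc {E : Type*} [AddCommGroup E] {N : ℕ} (F : Fin (N + 1) → E) :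
    ∑ k : Fin N, (F k.succ - F k.castSucc) = F (Fin.last N) - F 0 := by
  rw [Finset.sum_sub_distrib, sub_eq_sub_iff_add_eq_add, add_comm, ← Fin.sum_univ_succ,
    Fin.sum_univ_castSucc, add_comm]

/-- The point of the unit interval closest to a real number. -/
noncomputable def clampUnit (r : ℝ) : unitInterval := Set.projIcc 0 1 zero_le_one r

theorem coe_clampUnit {r : ℝ} (h0 : 0 ≤ r) (h1 : r ≤ 1) : (clampUnit r : ℝ) = r := by
  simp [clampUnit, Set.projIcc_of_mem zero_le_one (Set.mem_Icc.2 ⟨h0, h1⟩)]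

theorem clampUnit_coe (t : unitInterval) : clampUnit t = t := Set.projIcc_val zero_le_one t

theorem monotone_clampUnit : Monotone clampUnit := Set.monotone_projIcc zero_le_one

theorem abs_clampUnit_sub_le (r s : ℝ) : |(clampUnit r : ℝ) - clampUnit s| ≤ |r - s| := by
  exact Set.abs_projIcc_sub_projIcc zero_le_one

section Gronwall

/-- A Gronwall inequality for functions whose increments are controlled up to a quadratic error. -/
theorem le_exp_mul_of_increment_le {u : unitInterval → ℝ} {a b C : ℝ} (ha : 0 ≤ a) (hb : 0 ≤ b)
    (hC : 0 ≤ C) (hu : ∀ t, 0 ≤ u t)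
    (h : ∀ s t : unitInterval, s ≤ t →
      u t ≤ u s * (1 + a * (t - s)) + b * (t - s) + C * ((t : ℝ) - s) ^ 2)
    {s t : unitInterval} (hst : s ≤ t) :
    u t ≤ Real.exp (a * (t - s)) * (u s + b * (t - s)) := by
  have hts : (0 : ℝ) ≤ t - s := sub_nonneg.2 hst
  -- Cut `[s, t]` into `N + 1` equal steps: the quadratic errors add up to order `1 / (N + 1)` and
  -- vanish in the limit.
  have key : ∀ N : ℕ, u t ≤ Real.exp (a * (t - s))
      * (u s + b * (t - s) + C * (t - s) ^ 2 * (1 / ((N : ℝ) + 1))) := by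
    intro N
    set e : ℝ := (t - s) / ((N : ℝ) + 1) with he
    have he0 : 0 ≤ e := by positivity
    have hNe : ((N : ℝ) + 1) * e = t - s := by rw [he]; field_simp
    have hT : ∀ k : ℕ, k ≤ N + 1 → (clampUnit (s + k * e) : ℝ) = s + k * e := fun k hk => by
      have h1 : (k : ℝ) * e ≤ (N + 1) * e := by gcongr; exact_mod_cast hk
      exact coe_clampUnit (by have := s.2.1; positivity) (by linarith [t.2.2])
    have ind : ∀ k : ℕ, k ≤ N + 1 → u (clampUnit (s + k * e))
        ≤ Real.exp (a * (k * e)) * (u s + b * (k * e) + C * k * e ^ 2) := by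
      intro k
      induction k with
      | zero => intro _; simp [clampUnit_coe]
      | succ k ih =>
        intro hk
        have ih := ih (by omega)
        have h1 := h (clampUnit (s + k * e)) (clampUnit (s + (k + 1 : ℕ) * e))
          (monotone_clampUnit (by push_cast; gcongr; linarith))
        rw [hT _ hk, hT k (by omega)] at h1
        have h2 : (s : ℝ) + (k + 1 : ℕ) * e - (s + k * e) = e := by push_cast; ring
        rw [h2] at h1
        have h3 : 1 + a * e ≤ Real.exp (a * e) := by linarith [Real.add_one_le_exp (a * e)]
        have h4 : Real.exp (a * ((k + 1 : ℕ) * e)) = Real.exp (a * (k * e)) * Real.exp (a * e) := by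
          rw [← Real.exp_add]; congr 1; push_cast; ring
        have h5 : 1 ≤ Real.exp (a * ((k + 1 : ℕ) * e)) := Real.one_le_exp (by positivity)
        have hus := hu s
        calc _ ≤ _ := h1
          _ ≤ (Real.exp (a * (k * e)) * (u s + b * (k * e) + C * k * e ^ 2)) * Real.exp (a * e)
              + b * e + C * e ^ 2 := by
            gcongr
          _ = Real.exp (a * ((k + 1 : ℕ) * e)) * (u s + b * (k * e) + C * k * e ^ 2)
              + 1 * (b * e + C * e ^ 2) := by rw [h4]; ring
          _ ≤ Real.exp (a * ((k + 1 : ℕ) * e)) * (u s + b * (k * e) + C * k * e ^ 2)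
              + Real.exp (a * ((k + 1 : ℕ) * e)) * (b * e + C * e ^ 2) := by
            gcongr
          _ = _ := by push_cast; ring
    have := ind (N + 1) le_rfl
    push_cast at this
    rw [hNe, add_sub_cancel, clampUnit_coe] at this
    refine this.trans (le_of_eq ?_)
    congr 2
    rw [mul_assoc, pow_two, ← mul_assoc _ e e, hNe, he]
    ring
  have lim : Tendsto (fun N : ℕ => Real.exp (a * (t - s))
      * (u s + b * (t - s) + C * (t - s) ^ 2 * (1 / ((N : ℝ) + 1)))) atTop
      (𝓝 (Real.exp (a * (t - s)) * (u s + b * (t - s) + C * (t - s) ^ 2 * 0))) :=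
    ((tendsto_one_div_add_atTop_nhds_zero_nat.const_mul _).const_add _).const_mul _
  simpa using ge_of_tendsto' lim key

end Gronwall

variable {p d : ℕ} {G : Vec p → Matrix (Fin p) (Fin d) ℝ} {z₀ : Vec p} {x : DrivingPath d}
  {z : unitInterval → Vec p} {L Lx : ℝ}

theorem norm_sub_le_of_le (hx : ∀ s t : unitInterval, ‖x s - x t‖ ≤ Lx * |(s : ℝ) - t|)
    {s t : unitInterval} (hst : s ≤ t) : ‖x t - x s‖ ≤ Lx * (t - s) := by
  simpa [abs_of_nonneg (sub_nonneg.2 (show (s : ℝ) ≤ t from hst))] using hx t s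

/-- Left-endpoint sums over partitions indexed by `ℕ`, so that an initial segment of a partition is
again one. -/
theorem HasRSIntegral.norm_sum_range_sub_lt {f : unitInterval → Matrix (Fin p) (Fin d) ℝ}
    {a b : unitInterval} {J : Vec p} (h : HasRSIntegral f x a b J) {η : ℝ} (hη : 0 < η) :
    ∃ δ : ℝ, 0 < δ ∧ ∀ (N : ℕ) (T : ℕ → unitInterval), Monotone T → T 0 = a → T N = b →
      (∀ k, (T (k + 1) : ℝ) - T k < δ) →
      ‖(∑ k ∈ Finset.range N, app (f (T k)) (x (T (k + 1)) - x (T k))) - J‖ < η := by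
  obtain ⟨δ, hδ, H⟩ := h η hη
  refine ⟨δ, hδ, fun N T hT h0 hN hs => ?_⟩
  have := H N (fun k => T k) (fun k => T k) (fun i j hij => hT (by exact_mod_cast hij))
    (by simpa using h0) (by simpa using hN)
    (fun k => ⟨le_of_eq (by simp), hT (by simp)⟩) (fun k => by simpa using hs k)
  simpa [Finset.sum_range] using this

/-- The increments of a solution are close to those of the path, transported by a fixed matrix that
is close to the vector field along the solution. -/
theorem IsCDESolution.norm_increment_sub_le (h : IsCDESolution G z₀ x z)
    (hx : ∀ s t : unitInterval, ‖x s - x t‖ ≤ Lx * |(s : ℝ) - t|) (A : Matrix (Fin p) (Fin d) ℝ)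
    {M : ℝ} {s t : unitInterval} (hst : s ≤ t)
    (hM : ∀ r, s ≤ r → r ≤ t → opNorm (G (z r) - A) ≤ M) :
    ‖z t - z s - app A (x t - x s)‖ ≤ M * (Lx * (t - s)) := by
  have hst' : (s : ℝ) ≤ t := hst
  have hs0 : (0 : ℝ) ≤ s := s.2.1
  have ht1 : (t : ℝ) ≤ 1 := t.2.2
  have hM0 : 0 ≤ M := (opNorm_nonneg _).trans (hM s le_rfl hst)
  refine le_of_forall_pos_le_add fun η hη => ?_
  obtain ⟨δ₁, hδ₁, H₁⟩ := (h.2.2 s).norm_sum_range_sub_lt (half_pos hη)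
  obtain ⟨δ₂, hδ₂, H₂⟩ := (h.2.2 t).norm_sum_range_sub_lt (half_pos hη)
  obtain ⟨N, hN⟩ := exists_nat_one_div_lt (lt_min hδ₁ hδ₂)
  -- `N + 1` equal steps from `0` to `s`, then `N + 1` equal steps from `s` to `t`; the minimum and
  -- the truncated subtraction glue the two pieces. The same partition serves the integrals up to
  -- `s` and up to `t`, so their difference is a sum over `[s, t]` and additivity of the integral is
  -- not needed.
  set T' : ℕ → ℝ := fun k => s * (min k (N + 1) : ℕ) / ((N : ℝ) + 1)
    + (t - s) * (k - (N + 1) : ℕ) / ((N : ℝ) + 1) with hT'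
  set T : ℕ → unitInterval := fun k => clampUnit (T' k) with hTdef
  have hT'm : Monotone T' := fun i j hij => by
    simp only [hT']
    have : (0 : ℝ) ≤ t - s := by linarith
    gcongr
  have hTm : Monotone T := monotone_clampUnit.comp hT'm
  have e0 : T 0 = 0 := by
    have : T' 0 = ((0 : unitInterval) : ℝ) := by
      simp only [hT', Nat.zero_min, Nat.zero_sub]; simp
    simp only [hTdef, this, clampUnit_coe]
  have e1 : T (N + 1) = s := by
    have : T' (N + 1) = s := by
      simp only [hT', min_self, Nat.sub_self]; push_cast; field_simp; ring
    simp only [hTdef, this, clampUnit_coe]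
  have e2 : T (N + 1 + (N + 1)) = t := by
    have : T' (N + 1 + (N + 1)) = t := by
      simp only [hT', min_eq_right (Nat.le_add_left (N + 1) (N + 1)), Nat.add_sub_cancel]
      push_cast; field_simp; ring
    simp only [hTdef, this, clampUnit_coe]
  have hstep : ∀ k, (T (k + 1) : ℝ) - T k < min δ₁ δ₂ := by
    intro k
    refine lt_of_le_of_lt ?_ hN
    refine (le_abs_self _).trans ((abs_clampUnit_sub_le _ _).trans ?_)
    rw [abs_of_nonneg (sub_nonneg.2 (hT'm (Nat.le_succ k)))]
    simp only [hT']
    rcases le_or_gt (N + 1) k with hk | hk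
    · rw [min_eq_right (by omega), min_eq_right (by omega), Nat.succ_sub hk]
      push_cast
      rw [show ∀ a b c e : ℝ, a + b * (c + 1) / e - (a + b * c / e) = b / e by intros; ring]
      gcongr
      linarith
    · rw [min_eq_left (by omega), min_eq_left (by omega), Nat.sub_eq_zero_of_le (by omega),
        Nat.sub_eq_zero_of_le (by omega)]
      push_cast
      rw [show ∀ a b c e : ℝ, a * (c + 1) / e + b * 0 / e - (a * c / e + b * 0 / e) = a / e by
        intros; ring]
      gcongr
      linarith
  have K₁ := H₁ (N + 1) T hTm e0 e1 fun k => (hstep k).trans_le (min_le_left _ _)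
  have K₂ := H₂ (N + 1 + (N + 1)) T hTm e0 e2 fun k => (hstep k).trans_le (min_le_right _ _)
  set g : ℕ → Vec p := fun k => app (G (z (T k))) (x (T (k + 1)) - x (T k)) with hg
  have hA : app A (x t - x s) = ∑ k ∈ Finset.range (N + 1),
      app A (x (T (N + 1 + k + 1)) - x (T (N + 1 + k))) := by
    have tel := Finset.sum_range_sub (fun k => app A (x (T (N + 1 + k)))) (N + 1)
    simp only [app_sub_right]
    rw [← e1, ← e2]
    exact tel.symm
  have main : ‖(∑ k ∈ Finset.range (N + 1), g (N + 1 + k)) - app A (x t - x s)‖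
      ≤ M * (Lx * (t - s)) := by
    rw [hA, ← Finset.sum_sub_distrib]
    have tel := Finset.sum_range_sub (fun k => (T (N + 1 + k) : ℝ)) (N + 1)
    simp only [add_zero, e1, e2] at tel
    rw [← tel, Finset.mul_sum, Finset.mul_sum]
    refine norm_sum_le_of_le _ fun k hk => ?_
    rw [hg, ← app_sub_left]
    refine (norm_app_le_opNorm _ _).trans ?_
    have hk := Finset.mem_range.1 hk
    gcongr
    · exact hM _ (e1 ▸ hTm (by omega)) (e2 ▸ hTm (by omega))
    · exact norm_sub_le_of_le hx (hTm (by omega))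
  rw [Finset.sum_range_add] at K₂
  set S₁ := ∑ k ∈ Finset.range (N + 1), g k
  set S₂ := ∑ k ∈ Finset.range (N + 1), g (N + 1 + k)
  have : z t - z s - app A (x t - x s)
      = (S₂ - app A (x t - x s)) - (S₁ + S₂ - (z t - z₀)) + (S₁ - (z s - z₀)) := by abel
  rw [this]
  refine (norm_add_le _ _).trans ?_
  have := norm_sub_le (S₂ - app A (x t - x s)) (S₁ + S₂ - (z t - z₀))
  linarith

theorem opNorm_le_add (hG : ∀ u v : Vec p, ‖G u - G v‖ ≤ L * ‖u - v‖) (u v : Vec p) :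
    opNorm (G u) ≤ opNorm (G v) + L * ‖u - v‖ := by
  have h1 := opNorm_sub_le (G u - G v) (-G v)
  have h2 : opNorm (-G v) = opNorm (G v) := by simp [opNorm]
  have h3 := (opNorm_le_norm (G u - G v)).trans (hG u v)
  rw [sub_neg_eq_add, sub_add_cancel] at h1
  linarith

theorem IsCDESolution.norm_increment_le (h : IsCDESolution G z₀ x z)
    (hx : ∀ s t : unitInterval, ‖x s - x t‖ ≤ Lx * |(s : ℝ) - t|)
    {M : ℝ} {s t : unitInterval} (hst : s ≤ t)
    (hM : ∀ r, s ≤ r → r ≤ t → opNorm (G (z r)) ≤ M) :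
    ‖z t - z s‖ ≤ M * (Lx * (t - s)) := by
  simpa [app_zero_left] using h.norm_increment_sub_le hx 0 hst (by simpa using hM)

/-- The increments of a solution agree with those of the Euler scheme to second order. -/
theorem IsCDESolution.exists_norm_increment_sub_le (h : IsCDESolution G z₀ x z) (hL : 0 ≤ L)
    (hLx : 0 ≤ Lx) (hG : ∀ u v : Vec p, ‖G u - G v‖ ≤ L * ‖u - v‖)
    (hx : ∀ s t : unitInterval, ‖x s - x t‖ ≤ Lx * |(s : ℝ) - t|) :
    ∃ C : ℝ, 0 ≤ C ∧ ∀ s t : unitInterval, s ≤ t →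
      ‖z t - z s - app (G (z s)) (x t - x s)‖ ≤ C * ((t : ℝ) - s) ^ 2 := by
  -- A crude bound by compactness is enough: the constant `C` disappears in the Gronwall inequality.
  obtain ⟨R, hR⟩ := isCompact_univ.exists_bound_of_continuousOn (h.1.continuousOn (s := Set.univ))
  have hR0 : 0 ≤ R := (norm_nonneg _).trans (hR 0 trivial)
  set B := opNorm (G 0) + L * R
  have hB0 : 0 ≤ B := add_nonneg (opNorm_nonneg _) (by positivity)
  have hB : ∀ r, opNorm (G (z r)) ≤ B := fun r => by
    refine (opNorm_le_add hG (z r) 0).trans ?_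
    have := hR r trivial
    rw [sub_zero]
    exact add_le_add le_rfl (mul_le_mul_of_nonneg_left this hL)
  refine ⟨L * (B * Lx) * Lx, by positivity, fun s t hst => ?_⟩
  have hst' : (0 : ℝ) ≤ t - s := sub_nonneg.2 hst
  refine (h.norm_increment_sub_le hx (G (z s)) (M := L * (B * (Lx * (t - s)))) hst
    fun r hsr hrt => ?_).trans (le_of_eq (by ring))
  refine (opNorm_le_norm _).trans ((hG _ _).trans ?_)
  gcongr
  refine (h.norm_increment_le hx hsr fun r _ _ => hB r).trans ?_
  have : (r : ℝ) ≤ t := hrt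
  gcongr

/-- Gronwall for `‖z t‖`, with `opNorm (G u) ≤ opNorm (G 0) + L * ‖u‖`. This bound confines neural
trajectories to `Ω`. -/
theorem IsCDESolution.norm_le (h : IsCDESolution G z₀ x z) (hL : 0 ≤ L)
    (hLx : 0 ≤ Lx) (hG : ∀ u v : Vec p, ‖G u - G v‖ ≤ L * ‖u - v‖)
    (hx : ∀ s t : unitInterval, ‖x s - x t‖ ≤ Lx * |(s : ℝ) - t|) (t : unitInterval) :
    ‖z t‖ ≤ Real.exp (L * Lx * t) * (‖z₀‖ + opNorm (G 0) * Lx * t) := by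
  obtain ⟨C, hC, H⟩ := h.exists_norm_increment_sub_le hL hLx hG hx
  have hG0 := opNorm_nonneg (G 0)
  have := le_exp_mul_of_increment_le (u := fun t => ‖z t‖) (a := L * Lx) (b := opNorm (G 0) * Lx)
    (by positivity) (by positivity) hC (fun _ => norm_nonneg _) (fun s t hst => ?_)
    (show (0 : unitInterval) ≤ t from t.2.1)
  · simpa [h.2.1] using this
  have e : z t = z s + app (G (z s)) (x t - x s) + (z t - z s - app (G (z s)) (x t - x s)) := by
    abel
  have h1 : ‖app (G (z s)) (x t - x s)‖ ≤ (opNorm (G 0) + L * ‖z s‖) * (Lx * (t - s)) := by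
    refine (norm_app_le_opNorm _ _).trans ?_
    gcongr
    · simpa using opNorm_le_add hG (z s) 0
    · exact norm_sub_le_of_le hx hst
  have h2 := norm_add₃_le (a := z s) (b := app (G (z s)) (x t - x s))
    (c := z t - z s - app (G (z s)) (x t - x s))
  rw [← e] at h2
  have h3 := H s t hst
  linarith

/-- The size of the field along the solution changes at a rate proportional to itself, so Gronwall
applies without an additive term. The speed is thus controlled by `opNorm (G z₀)` alone, which is
why only the initial value enters the discretization error. -/
theorem IsCDESolution.opNorm_le (h : IsCDESolution G z₀ x z) (hL : 0 ≤ L)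
    (hLx : 0 ≤ Lx) (hG : ∀ u v : Vec p, ‖G u - G v‖ ≤ L * ‖u - v‖)
    (hx : ∀ s t : unitInterval, ‖x s - x t‖ ≤ Lx * |(s : ℝ) - t|) (t : unitInterval) :
    opNorm (G (z t)) ≤ Real.exp (L * Lx * t) * opNorm (G z₀) := by
  obtain ⟨C, hC, H⟩ := h.exists_norm_increment_sub_le hL hLx hG hx
  have := le_exp_mul_of_increment_le (u := fun t => opNorm (G (z t))) (a := L * Lx) (b := 0)
    (C := L * C) (by positivity) le_rfl (by positivity) (fun _ => opNorm_nonneg _)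
    (fun s t hst => ?_) (show (0 : unitInterval) ≤ t from t.2.1)
  · simpa [h.2.1] using this
  have h1 := opNorm_le_add hG (z t) (z s)
  have h2 : ‖z t - z s‖ ≤ C * ((t : ℝ) - s) ^ 2 + opNorm (G (z s)) * (Lx * (t - s)) := by
    refine (norm_le_norm_sub_add _ (app (G (z s)) (x t - x s))).trans ?_
    refine add_le_add (H s t hst) ((norm_app_le_opNorm _ _).trans ?_)
    gcongr
    · exact opNorm_nonneg _
    · exact norm_sub_le_of_le hx hst
  have h3 := mul_le_mul_of_nonneg_left h2 hL
  linarith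

theorem sub_le_mesh {K : ℕ} (D : Fin (K + 1) → unitInterval) (k : Fin K) :
    (D k.succ : ℝ) - D k.castSucc ≤ mesh D :=
  le_ciSup (f := fun k : Fin K => (D k.succ : ℝ) - D k.castSucc) (Set.finite_range _).bddAbove k

/-- The error of the Euler scheme on a grid. -/
theorem IsCDESolution.norm_sub_resnetTerminal_le (h : IsCDESolution G z₀ x z) (hL : 0 ≤ L)
    (hLx : 0 ≤ Lx) (hG : ∀ u v : Vec p, ‖G u - G v‖ ≤ L * ‖u - v‖)
    (hx : ∀ s t : unitInterval, ‖x s - x t‖ ≤ Lx * |(s : ℝ) - t|) {K : ℕ}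
    {D : Fin (K + 1) → unitInterval} (hD : IsGrid D) :
    ‖z 1 - resnetTerminal G z₀ (sampleOn D x)‖
      ≤ Real.exp (L * Lx) * (L * Lx * Lx * mesh D * opNorm (G z₀)) := by
  set a := L * Lx with ha
  have ha0 : 0 ≤ a := by positivity
  set g := opNorm (G z₀)
  have hg : 0 ≤ g := opNorm_nonneg _
  have := foldl_invariant (fun w k => w + app (G w) (sampleOn D x k.succ - sampleOn D x k.castSucc))
    -- The final factor `D k` accumulates the local errors: each is quadratic in its step, and one
    -- of the two factors is bounded by `mesh D`.
    z₀ (fun k w => ‖z (D k) - w‖ ≤ Real.exp (a * D k) * (a * Lx * mesh D * g * D k))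
    (by simp [hD.2.1, h.2.1]) ?_
  · simpa [hD.2.2, resnetTerminal] using this
  intro k w hw
  simp only [sampleOn] at hw ⊢
  have hk : D k.castSucc ≤ D k.succ := hD.1.monotone (Fin.castSucc_lt_succ).le
  have hδ0 : (0 : ℝ) ≤ D k.succ - D k.castSucc := sub_nonneg.2 hk
  have hδm := sub_le_mesh D k
  set s := D k.castSucc with hs
  set t := D k.succ with ht
  have hs0 : (0 : ℝ) ≤ s := s.2.1
  have hsup : ∀ r, r ≤ t → opNorm (G (z r)) ≤ Real.exp (a * t) * g := fun r hr => by
    refine (h.opNorm_le hL hLx hG hx r).trans ?_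
    have : (r : ℝ) ≤ t := hr
    gcongr
  have loc : ‖z t - z s - app (G (z s)) (x t - x s)‖
      ≤ L * (Real.exp (a * t) * g * (Lx * (t - s))) * (Lx * (t - s)) := by
    refine h.norm_increment_sub_le hx _ hk fun r hsr hrt => ?_
    refine (opNorm_le_norm _).trans ((hG _ _).trans ?_)
    gcongr
    refine (h.norm_increment_le hx hsr fun r' _ hr' => hsup r' (hr'.trans hrt)).trans ?_
    have : (r : ℝ) ≤ t := hrt
    gcongr
  have prop : ‖app (G (z s) - G w) (x t - x s)‖ ≤ L * ‖z s - w‖ * (Lx * (t - s)) := by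
    refine (norm_app_le _ _).trans ?_
    gcongr
    · exact hG _ _
    · exact norm_sub_le_of_le hx hk
  have e : z t - (w + app (G w) (x t - x s)) = (z t - z s - app (G (z s)) (x t - x s))
      + (z s - w) + app (G (z s) - G w) (x t - x s) := by
    rw [app_sub_left]; abel
  have hexp : Real.exp (a * t) = Real.exp (a * s) * Real.exp (a * (t - s)) := by
    rw [← Real.exp_add]; congr 1; ring
  have h1 : 1 + a * (t - s) ≤ Real.exp (a * (t - s)) := by
    linarith [Real.add_one_le_exp (a * (t - s))]
  have hm0 : 0 ≤ mesh D := hδ0.trans hδm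
  calc ‖z t - (w + app (G w) (x t - x s))‖
      ≤ ‖z t - z s - app (G (z s)) (x t - x s)‖ + ‖z s - w‖
        + ‖app (G (z s) - G w) (x t - x s)‖ := by rw [e]; exact norm_add₃_le
    _ ≤ L * (Real.exp (a * t) * g * (Lx * (t - s))) * (Lx * (t - s)) + ‖z s - w‖
        + L * ‖z s - w‖ * (Lx * (t - s)) := by gcongr
    _ = Real.exp (a * t) * (a * Lx * (t - s) * g * (t - s)) + ‖z s - w‖ * (1 + a * (t - s)) := by
        rw [ha]; ring
    _ ≤ Real.exp (a * t) * (a * Lx * mesh D * g * (t - s))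
        + Real.exp (a * s) * (a * Lx * mesh D * g * s) * Real.exp (a * (t - s)) := by gcongr
    _ = _ := by rw [hexp]; ring

/-- Stability of solutions under perturbations of the vector field and of the initial value. -/
theorem IsCDESolution.norm_sub_le_of_opNorm_le {H : Vec p → Matrix (Fin p) (Fin d) ℝ}
    {w₀ : Vec p} {w : unitInterval → Vec p} (h : IsCDESolution G z₀ x z)
    (h' : IsCDESolution H w₀ x w) {L' : ℝ} (hL : 0 ≤ L) (hL' : 0 ≤ L') (hLx : 0 ≤ Lx)
    (hG : ∀ u v : Vec p, ‖G u - G v‖ ≤ L * ‖u - v‖)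
    (hH : ∀ u v : Vec p, ‖H u - H v‖ ≤ L' * ‖u - v‖)
    (hx : ∀ s t : unitInterval, ‖x s - x t‖ ≤ Lx * |(s : ℝ) - t|) {M : ℝ}
    (hM : ∀ t, opNorm (G (z t) - H (z t)) ≤ M) :
    ‖z 1 - w 1‖ ≤ Real.exp (L' * Lx) * (‖z₀ - w₀‖ + Lx * M) := by
  obtain ⟨C, hC, E⟩ := h.exists_norm_increment_sub_le hL hLx hG hx
  obtain ⟨C', hC', E'⟩ := h'.exists_norm_increment_sub_le hL' hLx hH hx
  have hM0 : 0 ≤ M := (opNorm_nonneg _).trans (hM 0)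
  have := le_exp_mul_of_increment_le (u := fun t => ‖z t - w t‖) (a := L' * Lx) (b := Lx * M)
    (C := C + C') (by positivity) (by positivity) (by positivity) (fun _ => norm_nonneg _)
    (fun s t hst => ?_) (show (0 : unitInterval) ≤ 1 from zero_le_one)
  · simpa [h.2.1, h'.2.1] using this
  -- Inserting `H (z s)` compares the two fields only along `z`, and leaves only the Lipschitz
  -- constant of `H` in the exponent.
  have e : z t - w t = (z s - w s) + app (G (z s) - H (z s)) (x t - x s)
      + app (H (z s) - H (w s)) (x t - x s)
      + ((z t - z s - app (G (z s)) (x t - x s)) - (w t - w s - app (H (w s)) (x t - x s))) := by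
    rw [app_sub_left, app_sub_left]; abel
  have hxst := norm_sub_le_of_le hx hst
  have h1 : ‖app (G (z s) - H (z s)) (x t - x s)‖ ≤ M * (Lx * (t - s)) := by
    refine (norm_app_le_opNorm _ _).trans ?_
    gcongr
    exact hM s
  have h2 : ‖app (H (z s) - H (w s)) (x t - x s)‖ ≤ L' * ‖z s - w s‖ * (Lx * (t - s)) := by
    refine (norm_app_le _ _).trans ?_
    gcongr
    exact hH _ _
  have h3 := norm_add₄_le (a := z s - w s) (b := app (G (z s) - H (z s)) (x t - x s))
    (c := app (H (z s) - H (w s)) (x t - x s))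
    (d := (z t - z s - app (G (z s)) (x t - x s)) - (w t - w s - app (H (w s)) (x t - x s)))
  have h4 := norm_sub_le (z t - z s - app (G (z s)) (x t - x s))
    (w t - w s - app (H (w s)) (x t - x s))
  rw [← e] at h3
  have h5 := E s t hst
  have h6 := E' s t hst
  linarith

/-! ### Existence of solutions through limits of Euler schemes; continuity and bounds for the
discrete recursion -/

section Existence

variable {p d : ℕ} {G : Vec p → Matrix (Fin p) (Fin d) ℝ} {z₀ : Vec p} {x : DrivingPath d}
  {z : unitInterval → Vec p} {L Lx : ℝ}

theorem abs_apply_le_frobenius_norm {m k : ℕ} (M : Matrix (Fin m) (Fin k) ℝ) (i : Fin m)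
    (j : Fin k) : |M i j| ≤ ‖M‖ := by
  refine abs_le_of_sq_le_sq ?_ (norm_nonneg _)
  rw [frobenius_norm_sq]
  exact (Finset.single_le_sum (f := fun j => M i j ^ 2) (fun _ _ => sq_nonneg _)
    (Finset.mem_univ j)).trans (Finset.single_le_sum (f := fun i => ∑ j, M i j ^ 2)
    (fun _ _ => Finset.sum_nonneg fun _ _ => sq_nonneg _) (Finset.mem_univ i))

theorem continuous_app_comp (hL : 0 ≤ L) (hG : ∀ u v : Vec p, ‖G u - G v‖ ≤ L * ‖u - v‖) :
    Continuous fun w : Vec p × Vec d => app (G w.1) w.2 := by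
  have hij : ∀ i j, Continuous fun u => G u i j := fun i j =>
    (LipschitzWith.of_dist_le_mul (K := NNReal.mk L hL) fun u v => by
      rw [dist_eq_norm, dist_eq_norm]
      exact (abs_apply_le_frobenius_norm (G u - G v) i j).trans (hG u v)).continuous
  refine (PiLp.continuous_toLp 2 _).comp (continuous_pi fun i => ?_)
  change Continuous fun w : Vec p × Vec d => app (G w.1) w.2 i
  simp only [app_apply]
  refine continuous_finsetSum _ fun j _ => ((hij i j).comp continuous_fst).mul ?_
  exact (EuclideanSpace.proj j : Vec d →L[ℝ] ℝ).continuous.comp continuous_snd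

/-- A curve whose increments agree with those of the Euler scheme to second order is a solution. -/
theorem isCDESolution_of_norm_increment_sub_le (hL : 0 ≤ L) (hLx : 0 ≤ Lx)
    (hG : ∀ u v : Vec p, ‖G u - G v‖ ≤ L * ‖u - v‖)
    (hx : ∀ s t : unitInterval, ‖x s - x t‖ ≤ Lx * |(s : ℝ) - t|) (h0 : z 0 = z₀) {B C : ℝ}
    (hB : 0 ≤ B) (hC : 0 ≤ C) (hz : ∀ s t : unitInterval, s ≤ t → ‖z t - z s‖ ≤ B * (t - s))
    (h : ∀ s t : unitInterval, s ≤ t →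
      ‖z t - z s - app (G (z s)) (x t - x s)‖ ≤ C * ((t : ℝ) - s) ^ 2) :
    IsCDESolution G z₀ x z := by
  refine ⟨?_, h0, fun t η hη => ?_⟩
  · refine (LipschitzWith.of_dist_le_mul (K := NNReal.mk B hB) fun u v => ?_).continuous
    rw [dist_eq_norm, Subtype.dist_eq, Real.dist_eq, NNReal.coe_mk]
    rcases le_total u v with huv | huv
    · rw [norm_sub_rev, abs_sub_comm, abs_of_nonneg (sub_nonneg.2 (Subtype.coe_le_coe.2 huv))]
      exact hz u v huv
    · rw [abs_of_nonneg (sub_nonneg.2 (Subtype.coe_le_coe.2 huv))]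
      exact hz v u huv
  -- Per squared step length: `L * B * Lx` for moving the tag to the left endpoint, `C` for
  -- replacing the increment of `z` by an Euler step.
  set C' := L * B * Lx + C with hC'
  have hC'0 : 0 ≤ C' := by positivity
  refine ⟨η / (C' + 1), by positivity, fun N T S hT hT0 hTN hS hδ => ?_⟩
  set δ := η / (C' + 1) with hδdef
  have hTk : ∀ k : Fin N, T k.castSucc ≤ T k.succ := fun k => hT Fin.castSucc_lt_succ.le
  have e1 := sum_succ_sub_castSucc (fun k => z (T k))
  have e2 := sum_succ_sub_castSucc (fun k => (T k : ℝ))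
  simp only [hT0, hTN, h0] at e1 e2
  rw [← e1, ← Finset.sum_sub_distrib]
  have hδ0 : 0 ≤ δ := by positivity
  have : ‖∑ k : Fin N, (app (G (z (S k))) (x (T k.succ) - x (T k.castSucc))
      - (z (T k.succ) - z (T k.castSucc)))‖ ≤ C' * δ * ((t : ℝ) - (0 : unitInterval)) := by
    rw [← e2, Finset.mul_sum]
    refine norm_sum_le_of_le _ fun k _ => ?_
    have hk : (0 : ℝ) ≤ T k.succ - T k.castSucc := sub_nonneg.2 (hTk k)
    have e : app (G (z (S k))) (x (T k.succ) - x (T k.castSucc))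
        - (z (T k.succ) - z (T k.castSucc))
        = app (G (z (S k)) - G (z (T k.castSucc))) (x (T k.succ) - x (T k.castSucc))
          - (z (T k.succ) - z (T k.castSucc)
            - app (G (z (T k.castSucc))) (x (T k.succ) - x (T k.castSucc))) := by
      rw [app_sub_left]; abel
    have h1 : ‖app (G (z (S k)) - G (z (T k.castSucc))) (x (T k.succ) - x (T k.castSucc))‖
        ≤ L * (B * (T k.succ - T k.castSucc)) * (Lx * (T k.succ - T k.castSucc)) := by
      refine (norm_app_le _ _).trans ?_
      gcongr
      · refine (hG _ _).trans ?_
        gcongr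
        refine (hz _ _ (hS k).1).trans ?_
        have : (S k : ℝ) ≤ T k.succ := (hS k).2
        gcongr
      · exact norm_sub_le_of_le hx (hTk k)
    rw [e]
    refine (norm_sub_le _ _).trans ((add_le_add h1 (h _ _ (hTk k))).trans ?_)
    calc _ = C' * (T k.succ - T k.castSucc) * (T k.succ - T k.castSucc) := by rw [hC']; ring
      _ ≤ _ := by gcongr; exact (hδ k).le
  refine this.trans_lt ?_
  calc C' * δ * ((t : ℝ) - (0 : unitInterval)) ≤ C' * δ * 1 := by
        gcongr; simpa using t.2.2
    _ < (C' + 1) * δ := by rw [mul_one, add_mul]; have : 0 < δ := by positivity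
                           linarith
    _ = η := by rw [hδdef]; field_simp

/-- The Euler scheme with step `1 / N`. -/
noncomputable def eulerSeq (G : Vec p → Matrix (Fin p) (Fin d) ℝ) (z₀ : Vec p) (x : DrivingPath d)
    (N : ℕ) : ℕ → Vec p
  | 0 => z₀
  | k + 1 => eulerSeq G z₀ x N k + app (G (eulerSeq G z₀ x N k))
      (x (clampUnit ((k + 1 : ℕ) / (N : ℝ))) - x (clampUnit (k / (N : ℝ))))

theorem norm_clampUnit_step_le (hLx : 0 ≤ Lx)
    (hx : ∀ s t : unitInterval, ‖x s - x t‖ ≤ Lx * |(s : ℝ) - t|) (N k : ℕ) :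
    ‖x (clampUnit ((k + 1 : ℕ) / (N : ℝ))) - x (clampUnit (k / (N : ℝ)))‖ ≤ Lx * (1 / N) := by
  refine (hx _ _).trans ?_
  gcongr
  refine (abs_clampUnit_sub_le _ _).trans (le_of_eq ?_)
  rw [← sub_div, abs_div, Nat.abs_cast]
  push_cast
  simp

/-- Discrete Gronwall; for `k ≤ N` the bound is uniform in `N`, which gives the compactness used for
existence. -/
theorem norm_eulerSeq_le (hL : 0 ≤ L) (hLx : 0 ≤ Lx)
    (hG : ∀ u v : Vec p, ‖G u - G v‖ ≤ L * ‖u - v‖)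
    (hx : ∀ s t : unitInterval, ‖x s - x t‖ ≤ Lx * |(s : ℝ) - t|) (N k : ℕ) :
    ‖eulerSeq G z₀ x N k‖
      ≤ Real.exp (L * Lx * (k / N)) * (‖z₀‖ + opNorm (G 0) * Lx * (k / N)) := by
  have hG0 := opNorm_nonneg (G 0)
  induction k with
  | zero => simp [eulerSeq]
  | succ k ih =>
    rw [eulerSeq]
    set w := eulerSeq G z₀ x N k
    refine (norm_add_le _ _).trans ?_
    have h1 := (norm_app_le_opNorm (G w) _).trans (mul_le_mul (opNorm_le_add hG w 0)
      (norm_clampUnit_step_le hLx hx N k) (norm_nonneg _) (by positivity))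
    rw [sub_zero] at h1
    have h2 : 1 + L * Lx * (1 / N) ≤ Real.exp (L * Lx * (1 / N)) := by
      linarith [Real.add_one_le_exp (L * Lx * (1 / N))]
    have h3 : Real.exp (L * Lx * ((k + 1 : ℕ) / N))
        = Real.exp (L * Lx * (k / N)) * Real.exp (L * Lx * (1 / N)) := by
      rw [← Real.exp_add]; congr 1; push_cast; ring
    have h4 : 1 ≤ Real.exp (L * Lx * ((k + 1 : ℕ) / N)) := Real.one_le_exp (by positivity)
    calc _ ≤ ‖w‖ + (opNorm (G 0) + L * ‖w‖) * (Lx * (1 / N)) := by gcongr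
      _ = ‖w‖ * (1 + L * Lx * (1 / N)) + 1 * (opNorm (G 0) * Lx * (1 / N)) := by ring
      _ ≤ Real.exp (L * Lx * (k / N)) * (‖z₀‖ + opNorm (G 0) * Lx * (k / N))
            * Real.exp (L * Lx * (1 / N))
          + Real.exp (L * Lx * ((k + 1 : ℕ) / N)) * (opNorm (G 0) * Lx * (1 / N)) := by gcongr
      _ = _ := by rw [h3]; push_cast; ring

theorem norm_eulerSeq_sub_le (hLx : 0 ≤ Lx)
    (hx : ∀ s t : unitInterval, ‖x s - x t‖ ≤ Lx * |(s : ℝ) - t|) {N : ℕ} {B : ℝ}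
    (hB : ∀ k ≤ N, opNorm (G (eulerSeq G z₀ x N k)) ≤ B) (k m : ℕ) (hm : k + m ≤ N) :
    ‖eulerSeq G z₀ x N (k + m) - eulerSeq G z₀ x N k‖ ≤ B * Lx * (m / N) := by
  induction m with
  | zero => simp
  | succ m ih =>
    have ih := ih (by omega)
    rw [← add_assoc, eulerSeq]
    have h1 := (norm_app_le_opNorm (G (eulerSeq G z₀ x N (k + m))) _).trans (mul_le_mul
      (hB (k + m) (by omega)) (norm_clampUnit_step_le hLx hx N (k + m)) (norm_nonneg _)
      ((opNorm_nonneg _).trans (hB 0 (by omega))))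
    rw [add_sub_right_comm]
    refine (norm_add_le _ _).trans ((add_le_add ih h1).trans (le_of_eq ?_))
    push_cast
    ring

/-- The second-order property of solutions, already for the scheme and with a constant independent
of `N`, so that it passes to the limit. The sum of the errors over `m` steps is absorbed in `m ^ 2`.
-/
theorem norm_eulerSeq_increment_sub_le (hL : 0 ≤ L) (hLx : 0 ≤ Lx)
    (hG : ∀ u v : Vec p, ‖G u - G v‖ ≤ L * ‖u - v‖)
    (hx : ∀ s t : unitInterval, ‖x s - x t‖ ≤ Lx * |(s : ℝ) - t|) {N : ℕ} {B : ℝ}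
    (hB : ∀ k ≤ N, opNorm (G (eulerSeq G z₀ x N k)) ≤ B) (k m : ℕ) (hm : k + m ≤ N) :
    ‖eulerSeq G z₀ x N (k + m) - eulerSeq G z₀ x N k - app (G (eulerSeq G z₀ x N k))
        (x (clampUnit ((k + m : ℕ) / (N : ℝ))) - x (clampUnit (k / (N : ℝ))))‖
      ≤ L * B * Lx ^ 2 * (m / N) ^ 2 := by
  have hB0 : 0 ≤ B := (opNorm_nonneg _).trans (hB 0 (by omega))
  induction m with
  | zero => simp [app_zero_right]
  | succ m ih =>
    have ih := ih (by omega)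
    have h0 := norm_eulerSeq_sub_le hLx hx hB k m (by omega)
    rw [← add_assoc, eulerSeq]
    set w := eulerSeq G z₀ x N (k + m)
    set v := eulerSeq G z₀ x N k
    set a := x (clampUnit ((k + m + 1 : ℕ) / (N : ℝ)))
    set b := x (clampUnit ((k + m : ℕ) / (N : ℝ))) with hb
    set c := x (clampUnit (k / (N : ℝ)))
    have e : w + app (G w) (a - b) - v - app (G v) (a - c)
        = (w - v - app (G v) (b - c)) + app (G w - G v) (a - b) := by
      simp only [app_sub_left, app_sub_right]; abel
    have h1 : ‖app (G w - G v) (a - b)‖ ≤ L * (B * Lx * (m / N)) * (Lx * (1 / N)) := by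
      refine (norm_app_le _ _).trans ?_
      gcongr
      · refine (hG _ _).trans ?_
        gcongr
      · exact norm_clampUnit_step_le hLx hx N (k + m)
    rw [e]
    refine (norm_add_le _ _).trans ((add_le_add ih h1).trans ?_)
    have h2 : 0 ≤ L * B * Lx ^ 2 * ((m + 1 : ℝ) / N ^ 2) := by positivity
    have : L * B * Lx ^ 2 * ((m + 1 : ℕ) / N : ℝ) ^ 2 - (L * B * Lx ^ 2 * (m / N : ℝ) ^ 2
        + L * (B * Lx * (m / N)) * (Lx * (1 / N))) = L * B * Lx ^ 2 * ((m + 1 : ℝ) / N ^ 2) := by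
      push_cast; ring
    linarith

/-- Existence of solutions for Lipschitz vector fields and Lipschitz paths. -/
theorem exists_isCDESolution (hL : 0 ≤ L) (hLx : 0 ≤ Lx)
    (hG : ∀ u v : Vec p, ‖G u - G v‖ ≤ L * ‖u - v‖)
    (hx : ∀ s t : unitInterval, ‖x s - x t‖ ≤ Lx * |(s : ℝ) - t|) (z₀ : Vec p) :
    ∃ z, IsCDESolution G z₀ x z := by
  set R := Real.exp (L * Lx * 1) * (‖z₀‖ + opNorm (G 0) * Lx * 1)
  have hG0 := opNorm_nonneg (G 0)
  have hR : ∀ N k : ℕ, k ≤ N → ‖eulerSeq G z₀ x N k‖ ≤ R := fun N k hk => by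
    refine (norm_eulerSeq_le hL hLx hG hx N k).trans ?_
    have : (k : ℝ) / N ≤ 1 := div_le_one_of_le₀ (by exact_mod_cast hk) (by positivity)
    simp only [R]
    gcongr
  set B := opNorm (G 0) + L * R with hBdef
  have hR0 : 0 ≤ R := (norm_nonneg _).trans (hR 0 0 le_rfl)
  have hB0 : 0 ≤ B := by positivity
  have hB : ∀ N k : ℕ, k ≤ N → opNorm (G (eulerSeq G z₀ x N k)) ≤ B := fun N k hk => by
    refine (opNorm_le_add hG _ 0).trans ?_
    rw [sub_zero]
    exact add_le_add le_rfl (mul_le_mul_of_nonneg_left (hR N k hk) hL)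
  have hfl : ∀ (N : ℕ) (t : unitInterval), ⌊(t : ℝ) * N⌋₊ ≤ N := fun N t => by
    refine Nat.floor_le_of_le ?_
    exact mul_le_of_le_one_left (by positivity) t.2.2
  -- All values lie in one compact ball, so a nonprincipal ultrafilter provides limits at all times
  -- simultaneously, in place of an Arzelà–Ascoli extraction.
  have hlim : ∀ t : unitInterval, ∃ y : Vec p,
      Tendsto (fun N : ℕ => eulerSeq G z₀ x N ⌊(t : ℝ) * N⌋₊) (hyperfilter ℕ) (𝓝 y) := fun t => by
    obtain ⟨y, _, hy⟩ := (isCompact_closedBall (0 : Vec p) R).ultrafilter_le_nhds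
      ((hyperfilter ℕ).map fun N : ℕ => eulerSeq G z₀ x N ⌊(t : ℝ) * N⌋₊) (by
        refine le_principal_iff.2 (Ultrafilter.mem_map.2 (univ_mem' fun N => ?_))
        simpa using hR N _ (hfl N t))
    exact ⟨y, hy⟩
  choose z hz using hlim
  have hT : ∀ t : unitInterval,
      Tendsto (fun N : ℕ => (⌊(t : ℝ) * N⌋₊ : ℝ) / N) (hyperfilter ℕ) (𝓝 t) := fun t =>
    ((tendsto_nat_floor_mul_div_atTop t.2.1).comp tendsto_natCast_atTop_atTop).mono_left
      Nat.hyperfilter_le_atTop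
  have hxc : Continuous fun r : ℝ => x (clampUnit r) := by
    refine (LipschitzWith.of_dist_le_mul (K := NNReal.mk Lx hLx) fun u v => ?_).continuous
    rw [dist_eq_norm, Real.dist_eq, NNReal.coe_mk]
    exact (hx _ _).trans (mul_le_mul_of_nonneg_left (abs_clampUnit_sub_le _ _) hLx)
  have hm : ∀ (s t : unitInterval), s ≤ t → ∀ N : ℕ, ∃ m : ℕ, ⌊(t : ℝ) * N⌋₊ = ⌊(s : ℝ) * N⌋₊ + m :=
    fun s t hst N => Nat.exists_eq_add_of_le (Nat.floor_mono (by
      have : (s : ℝ) ≤ t := hst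
      gcongr))
  have hcast : ∀ (m k N l : ℕ), l = k + m → (m / N : ℝ) = l / N - k / N := by
    rintro m k N l rfl; push_cast; ring
  refine ⟨z, isCDESolution_of_norm_increment_sub_le hL hLx hG hx ?_ (B := B * Lx)
    (C := L * B * Lx ^ 2) (by positivity) (by positivity) ?_ ?_⟩
  · refine tendsto_nhds_unique (hz 0) ?_
    simp [eulerSeq]
  · intro s t hst
    refine le_of_tendsto_of_tendsto' ((hz t).sub (hz s)).norm
      (((hT t).sub (hT s)).const_mul (B * Lx)) fun N => ?_
    obtain ⟨m, hm⟩ := hm s t hst N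
    have := norm_eulerSeq_sub_le hLx hx (hB N) ⌊(s : ℝ) * N⌋₊ m (hm ▸ hfl N t)
    rwa [← hm, hcast m _ N _ hm] at this
  · intro s t hst
    have h1 := ((continuous_app_comp hL hG).tendsto (z s, x t - x s)).comp
      ((hz s).prodMk_nhds (((hxc.tendsto _).comp (hT t)).sub ((hxc.tendsto _).comp (hT s)) |>.trans
        (by rw [clampUnit_coe, clampUnit_coe])))
    refine le_of_tendsto_of_tendsto' (((hz t).sub (hz s)).sub h1).norm
      ((((hT t).sub (hT s)).pow 2).const_mul (L * B * Lx ^ 2)) fun N => ?_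
    obtain ⟨m, hm⟩ := hm s t hst N
    have := norm_eulerSeq_increment_sub_le hL hLx hG hx (hB N) ⌊(s : ℝ) * N⌋₊ m (hm ▸ hfl N t)
    rwa [← hm, hcast m _ N _ hm] at this

/-- Rules out the default value of `cdeTerminal`. The estimates above hold for every solution, so it
does not matter which one is chosen. -/
theorem exists_isCDESolution_cdeTerminal_eq (hL : 0 ≤ L) (hLx : 0 ≤ Lx)
    (hG : ∀ u v : Vec p, ‖G u - G v‖ ≤ L * ‖u - v‖)
    (hx : ∀ s t : unitInterval, ‖x s - x t‖ ≤ Lx * |(s : ℝ) - t|) (z₀ : Vec p) :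
    ∃ z, IsCDESolution G z₀ x z ∧ cdeTerminal G z₀ x = z 1 := by
  have h := exists_isCDESolution hL hLx hG hx z₀
  exact ⟨h.choose, h.choose_spec, by rw [cdeTerminal, dif_pos h]⟩

theorem continuous_resnetTerminal {K : ℕ} (hL : 0 ≤ L)
    (hG : ∀ u v : Vec p, ‖G u - G v‖ ≤ L * ‖u - v‖) {φ : Vec d → Vec p} (hφ : Continuous φ) :
    Continuous fun x : Series d K => resnetTerminal G (φ (x 0)) x := by
  -- The fold is moved to the space of functions of `x`, where continuity is an invariant of each
  -- step.
  have key : (fun x : Series d K => resnetTerminal G (φ (x 0)) x)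
      = Fin.foldl K (fun (F : Series d K → Vec p) k x =>
          F x + app (G (F x)) (x k.succ - x k.castSucc)) (fun x => φ (x 0)) := by
    funext x
    exact foldl_invariant₂ (fun z k => z + app (G z) (x k.succ - x k.castSucc))
      (fun (F : Series d K → Vec p) k x => F x + app (G (F x)) (x k.succ - x k.castSucc)) _ _
      (fun _ a F => a = F x) rfl (by rintro i a F rfl; rfl)
  rw [key]
  refine foldl_invariant _ _ (fun _ F => Continuous F) (by fun_prop) fun k F hF => ?_
  exact hF.add ((continuous_app_comp hL hG).comp (hF.prodMk (by fun_prop)))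

theorem norm_resnetTerminal_le {K : ℕ} (hL : 0 ≤ L) (hLx : 0 ≤ Lx)
    (hG : ∀ u v : Vec p, ‖G u - G v‖ ≤ L * ‖u - v‖)
    (hx : ∀ s t : unitInterval, ‖x s - x t‖ ≤ Lx * |(s : ℝ) - t|)
    {D : Fin (K + 1) → unitInterval} (hD : IsGrid D) (z₀ : Vec p) :
    ‖resnetTerminal G z₀ (sampleOn D x)‖
      ≤ Real.exp (L * Lx) * (‖z₀‖ + opNorm (G 0) * Lx)
        + Real.exp (L * Lx) * (L * Lx * Lx * mesh D * opNorm (G z₀)) := by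
  obtain ⟨z, hz⟩ := exists_isCDESolution hL hLx hG hx z₀
  have h1 := hz.norm_le hL hLx hG hx 1
  have h2 := hz.norm_sub_resnetTerminal_le hL hLx hG hx hD
  have h3 := norm_le_norm_add_norm_sub (z 1) (resnetTerminal G z₀ (sampleOn D x))
  simp only [Set.Icc.coe_one, mul_one] at h1
  linarith

end Existence

/-! ### Rademacher complexities of countable classes -/

section Contraction

theorem bddAbove_range_of_abs_le {ι : Type*} {g : ι → ℝ} {B : ℝ} (h : ∀ k, |g k| ≤ B) :
    BddAbove (Set.range g) :=
  ⟨B, Set.forall_mem_range.2 fun k => (le_abs_self _).trans (h k)⟩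

variable {ι : Type*} [Nonempty ι]

theorem abs_ciSup_le {g : ι → ℝ} {B : ℝ} (h : ∀ k, |g k| ≤ B) : |⨆ k, g k| ≤ B := by
  obtain ⟨k⟩ := ‹Nonempty ι›
  refine abs_le.2 ⟨(abs_le.1 (h k)).1.trans (le_ciSup (bddAbove_range_of_abs_le h) k), ?_⟩
  have : Nonempty ι := ⟨k⟩
  exact ciSup_le fun k => (le_abs_self _).trans (h k)

theorem abs_sum_sign_mul_le {n : ℕ} (s : Fin n → Bool) {a : Fin n → ℝ} {B : ℝ}
    (ha : ∀ i, |a i| ≤ B) : |∑ i, (if s i then (1 : ℝ) else -1) * a i| ≤ n * B := by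
  calc _ ≤ ∑ _i : Fin n, B := by
        refine (Finset.abs_sum_le_sum_abs _ _).trans (Finset.sum_le_sum fun i _ => ?_)
        rw [abs_mul]
        have : |(if s i then (1 : ℝ) else -1)| = 1 := by split_ifs <;> simp
        rw [this, one_mul]
        exact ha i
    _ = n * B := by simp

/-- Contraction for one sign. For indices `k`, `l` the left side is at most `c k + c l + |b k - b
l|`, and the sign of `b k - b l` decides which index is used in which supremum on the right. -/
theorem ciSup_add_add_ciSup_sub_le {c a b : ι → ℝ} {B : ℝ} (hc : ∀ k, |c k| ≤ B)
    (hb : ∀ k, |b k| ≤ B) (hab : ∀ k l, |a k - a l| ≤ |b k - b l|) :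
    (⨆ k, (c k + a k)) + (⨆ k, (c k - a k)) ≤ (⨆ k, (c k + b k)) + ⨆ k, (c k - b k) := by
  have h1 : BddAbove (Set.range fun k => c k + b k) := bddAbove_range_of_abs_le (B := B + B)
    fun k => (abs_add_le _ _).trans (add_le_add (hc k) (hb k))
  have h2 : BddAbove (Set.range fun k => c k - b k) := bddAbove_range_of_abs_le (B := B + B)
    fun k => (abs_sub _ _).trans (add_le_add (hc k) (hb k))
  refine ciSup_add_ciSup_le fun k l => ?_
  have h3 := (le_abs_self _).trans (hab k l)
  rcases abs_cases (b k - b l) with ⟨h, -⟩ | ⟨h, -⟩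
  · linarith [le_ciSup h1 k, le_ciSup h2 l]
  · linarith [le_ciSup h1 l, le_ciSup h2 k]

/-- The contraction principle for one-sided Rademacher averages. -/
theorem sum_ciSup_sign_le {n : ℕ} {c : ι → ℝ} {a b : ι → Fin n → ℝ} {B : ℝ} (hc : ∀ k, |c k| ≤ B)
    (ha : ∀ k i, |a k i| ≤ B) (hb : ∀ k i, |b k i| ≤ B)
    (hab : ∀ k l i, |a k i - a l i| ≤ |b k i - b l i|) :
    ∑ s : Fin n → Bool, ⨆ k, (c k + ∑ i, (if s i then (1 : ℝ) else -1) * a k i)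
      ≤ ∑ s : Fin n → Bool, ⨆ k, (c k + ∑ i, (if s i then (1 : ℝ) else -1) * b k i) := by
  -- The offset `c` is free: it absorbs the coordinate whose sign has been fixed while the other
  -- coordinates are treated by induction.
  induction n generalizing c B with
  | zero => simp
  | succ n ih =>
    have split : ∀ f : ι → Fin (n + 1) → ℝ,
        ∑ s : Fin (n + 1) → Bool, ⨆ k, (c k + ∑ i, (if s i then (1 : ℝ) else -1) * f k i)
        = (∑ s : Fin n → Bool, ⨆ k, ((c k + f k 0)
            + ∑ i, (if s i then (1 : ℝ) else -1) * f k i.succ))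
          + ∑ s : Fin n → Bool, ⨆ k, ((c k - f k 0)
            + ∑ i, (if s i then (1 : ℝ) else -1) * f k i.succ) := fun f => by
      rw [← (Fin.consEquiv fun _ => Bool).sum_comp, Fintype.sum_prod_type, Fintype.sum_bool]
      simp [Fin.consEquiv, Fin.sum_univ_succ, ← add_assoc, sub_eq_add_neg]
    rw [split a, split b]
    have i1 := ih (c := fun k => c k + a k 0) (a := fun k i => a k i.succ)
      (b := fun k i => b k i.succ) (B := B + B)
      (fun k => (abs_add_le _ _).trans (add_le_add (hc k) (ha k 0)))
      (fun k i => (ha k i.succ).trans (by linarith [(abs_nonneg _).trans (hc k)]))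
      (fun k i => (hb k i.succ).trans (by linarith [(abs_nonneg _).trans (hc k)]))
      (fun k l i => hab k l i.succ)
    have i2 := ih (c := fun k => c k - a k 0) (a := fun k i => a k i.succ)
      (b := fun k i => b k i.succ) (B := B + B)
      (fun k => (abs_sub _ _).trans (add_le_add (hc k) (ha k 0)))
      (fun k i => (ha k i.succ).trans (by linarith [(abs_nonneg _).trans (hc k)]))
      (fun k i => (hb k i.succ).trans (by linarith [(abs_nonneg _).trans (hc k)]))
      (fun k l i => hab k l i.succ)
    refine (add_le_add i1 i2).trans ?_
    rw [← Finset.sum_add_distrib, ← Finset.sum_add_distrib]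
    refine Finset.sum_le_sum fun s _ => ?_
    have := ciSup_add_add_ciSup_sub_le (B := B + n * B)
      (c := fun k => c k + ∑ i, (if s i then (1 : ℝ) else -1) * b k i.succ)
      (a := fun k => a k 0) (b := fun k => b k 0)
      (fun k => (abs_add_le _ _).trans
        (add_le_add (hc k) (abs_sum_sign_mul_le s fun i => hb k i.succ)))
      (fun k => (hb k 0).trans (le_add_of_nonneg_right
        (mul_nonneg n.cast_nonneg ((abs_nonneg _).trans (hc k)))))
      (fun k l => hab k l 0)
    simpa only [add_right_comm, add_sub_right_comm] using this

variable {𝓧 : Type*} {n : ℕ}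

theorem empRademacher_range {ι : Type*} (h : ι → 𝓧 → ℝ) (ξ : Fin n → 𝓧) :
    empRademacher (Set.range h) ξ = (1 / (2 : ℝ) ^ n) * ∑ s : Fin n → Bool,
      ⨆ k, (1 / (n : ℝ)) * ∑ i, (if s i then (1 : ℝ) else -1) * h k (ξ i) := by
  simp only [empRademacher]
  congr 1
  refine Finset.sum_congr rfl fun s _ => ?_
  exact iSup_range' (fun f : 𝓧 → ℝ => (1 / (n : ℝ)) * ∑ i, (if s i then (1 : ℝ) else -1) * f (ξ i)) h

/-- The empirical Rademacher complexity contracts under Lipschitz maps. -/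
theorem empRademacher_range_le_mul {𝓨 : Type*} (g : ι → 𝓨 → ℝ) (h : ι → 𝓧 → ℝ) (υ : Fin n → 𝓨)
    (ξ : Fin n → 𝓧) {L B : ℝ} (hL : 0 ≤ L) (hg : ∀ k i, |g k (υ i)| ≤ B)
    (hh : ∀ k i, |h k (ξ i)| ≤ B)
    (hgh : ∀ k l i, |g k (υ i) - g l (υ i)| ≤ L * |h k (ξ i) - h l (ξ i)|) :
    empRademacher (Set.range g) υ ≤ L * empRademacher (Set.range h) ξ := by
  rcases Nat.eq_zero_or_pos n with rfl | hn
  · simp [empRademacher]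
  obtain ⟨k₀⟩ := ‹Nonempty ι›
  have hB0 : 0 ≤ B := (abs_nonneg _).trans (hg k₀ ⟨0, hn⟩)
  have : Nonempty ι := ⟨k₀⟩
  -- Putting `L` inside the second family reduces the claim to contraction with constant one.
  have key := sum_ciSup_sign_le (B := B + L * B) (c := fun _ : ι => 0) (a := fun k i => g k (υ i))
    (b := fun k i => L * h k (ξ i)) (fun k => by simp; positivity)
    (fun k i => (hg k i).trans (le_add_of_nonneg_right (by positivity)))
    (fun k i => by
      rw [abs_mul, abs_of_nonneg hL]
      nlinarith [hh k i])
    (fun k l i => by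
      rw [← mul_sub, abs_mul, abs_of_nonneg hL]
      exact hgh k l i)
  rw [empRademacher_range, empRademacher_range]
  simp only [zero_add, mul_left_comm _ L, ← Finset.mul_sum, ← Real.mul_iSup_of_nonneg hL] at key
  simp only [← Real.mul_iSup_of_nonneg (show (0 : ℝ) ≤ 1 / n by positivity), ← Finset.mul_sum]
  calc _ ≤ 1 / (2 : ℝ) ^ n * (1 / n * (L * _)) := by gcongr
    _ = _ := by ring

theorem abs_empRademacher_range_le {h : ℕ → 𝓧 → ℝ} {M : ℝ} {z : Fin n → 𝓧}
    (hM : ∀ k i, |h k (z i)| ≤ M) :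
    |empRademacher (Set.range h) z| ≤ 1 / (n : ℝ) * (n * M) := by
  rw [empRademacher_range, abs_mul, abs_of_nonneg (by positivity)]
  have : |∑ s : Fin n → Bool, ⨆ k, (1 / (n : ℝ)) *
      ∑ i, (if s i then (1 : ℝ) else -1) * h k (z i)| ≤ ∑ _s : Fin n → Bool, 1 / (n : ℝ) * (n * M) := by
    refine (Finset.abs_sum_le_sum_abs _ _).trans (Finset.sum_le_sum fun s _ => ?_)
    refine abs_ciSup_le fun k => ?_
    rw [abs_mul, abs_of_nonneg (by positivity)]
    gcongr
    exact abs_sum_sign_mul_le s (hM k)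
  refine (mul_le_mul_of_nonneg_left this (by positivity)).trans (le_of_eq ?_)
  simp

end Contraction

/-! ### Symmetrization with a ghost sample -/

section Symmetrization

variable {Z : Type*} [MeasurableSpace Z] {n : ℕ} {h : ℕ → Z → ℝ} {M : ℝ}

theorem measurable_empRademacher_range (hm : ∀ k, Measurable (h k)) :
    Measurable fun z : Fin n → Z => empRademacher (Set.range h) z := by
  simp only [empRademacher_range]
  refine (Finset.measurable_sum _ fun s _ => Measurable.iSup fun k => ?_).const_mul _
  have := hm k
  fun_prop

/-- Symmetrization: the expected uniform deviation of the empirical means from the means is at most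
twice the Rademacher complexity. -/
theorem integral_ciSup_sub_le (hn : 1 ≤ n) (μ : Measure Z) [IsProbabilityMeasure μ]
    (hm : ∀ k, Measurable (h k)) (hM : ∀ k z, |h k z| ≤ M) :
    ∫ z : Fin n → Z, ⨆ k, ((∫ u, h k u ∂μ) - (1 / (n : ℝ)) * ∑ i, h k (z i)) ∂(Measure.pi fun _ => μ)
      ≤ 2 * ∫ z : Fin n → Z, empRademacher (Set.range h) z ∂(Measure.pi fun _ => μ) := by
  set π : Measure (Fin n → Z) := Measure.pi fun _ => μ with hπ
  set ρ : Measure (Fin n → Z × Z) := Measure.pi fun _ => μ.prod μ with hρ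
  have hM0 : 0 ≤ M := (abs_nonneg _).trans (hM 0 (nonempty_of_isProbabilityMeasure μ).some)
  have hn0 : (n : ℝ) ≠ 0 := by positivity
  have hint : ∀ k, Integrable (h k) μ := fun k =>
    Integrable.of_bound (hm k).aestronglyMeasurable M (Eventually.of_forall (hM k))
  set S : (Fin n → Bool) → (Fin n → Z × Z) → ℝ := fun s w =>
    ⨆ k, (1 / (n : ℝ)) * ∑ i, (if s i then (1 : ℝ) else -1) * (h k (w i).2 - h k (w i).1) with hS
  have hSm : ∀ s, Measurable (S s) := fun s => Measurable.iSup fun k => by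
    have := hm k
    fun_prop
  have hdiff : ∀ k (w : Z × Z), |h k w.2 - h k w.1| ≤ M + M := fun k w =>
    (abs_sub _ _).trans (add_le_add (hM k _) (hM k _))
  have hterm : ∀ (s : Fin n → Bool) k (w : Fin n → Z × Z),
      |(1 / (n : ℝ)) * ∑ i, (if s i then (1 : ℝ) else -1) * (h k (w i).2 - h k (w i).1)|
        ≤ 1 / (n : ℝ) * (n * (M + M)) := fun s k w => by
    rw [abs_mul, abs_of_nonneg (by positivity)]
    gcongr
    exact abs_sum_sign_mul_le s fun i => hdiff k (w i)
  have hSb : ∀ s w, |S s w| ≤ 1 / (n : ℝ) * (n * (M + M)) := fun s w =>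
    abs_ciSup_le fun k => hterm s k w
  have hSi : ∀ s, Integrable (S s) ρ := fun s =>
    Integrable.of_bound (hSm s).aestronglyMeasurable _ (Eventually.of_forall (hSb s))
  -- a second, independent sample
  have ghost : ∫ z, ⨆ k, ((∫ u, h k u ∂μ) - (1 / (n : ℝ)) * ∑ i, h k (z i)) ∂π
      ≤ ∫ w, S (fun _ => true) w ∂ρ := by
    have mp := measurePreserving_arrowProdEquivProdArrow Z Z (Fin n) (fun _ => μ) (fun _ => μ)
    have e1 : ∫ w, S (fun _ => true) w ∂ρ
        = ∫ v : (Fin n → Z) × (Fin n → Z), S (fun _ => true) (fun i => (v.1 i, v.2 i)) ∂(π.prod π) := by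
      rw [← mp.integral_comp']
      rfl
    have hSm' : Measurable fun v : (Fin n → Z) × (Fin n → Z) =>
        S (fun _ => true) (fun i => (v.1 i, v.2 i)) :=
      (hSm _).comp (measurable_pi_lambda _ fun i => by fun_prop)
    have hSi' : Integrable (fun v : (Fin n → Z) × (Fin n → Z) =>
        S (fun _ => true) (fun i => (v.1 i, v.2 i))) (π.prod π) :=
      Integrable.of_bound hSm'.aestronglyMeasurable _ (Eventually.of_forall fun v => hSb _ _)
    rw [e1, integral_prod _ hSi']
    have hmean : ∀ k, |∫ u, h k u ∂μ| ≤ M := fun k => by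
      simpa using norm_integral_le_of_norm_le_const (μ := μ) (f := h k) (Eventually.of_forall (hM k))
    refine integral_mono (Integrable.of_bound (C := M + 1 / (n : ℝ) * (n * M))
      (Measurable.iSup fun k => ?_).aestronglyMeasurable (Eventually.of_forall fun z => ?_))
      hSi'.integral_prod_left fun z => ?_
    · have := hm k
      fun_prop
    · refine abs_ciSup_le fun k => (abs_sub _ _).trans (add_le_add (hmean k) ?_)
      rw [abs_mul, abs_of_nonneg (by positivity)]
      gcongr
      simpa using abs_sum_sign_mul_le (fun _ : Fin n => true) fun i => hM k (z i)
    · refine ciSup_le fun k => ?_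
      have hik : ∀ i : Fin n, Integrable (fun z' : Fin n → Z => h k (z' i)) π := fun i =>
        (measurePreserving_eval (fun _ : Fin n => μ) i).integrable_comp_of_integrable (hint k)
      have hid : ∀ i : Fin n, Integrable (fun z' : Fin n → Z => h k (z' i) - h k (z i)) π :=
        fun i => (hik i).sub (integrable_const _)
      -- The mean is an average over the ghost sample `z'`, so the supremum of integrals is at most
      -- the integral of the supremum.
      have e2 : (∫ u, h k u ∂μ) - (1 / (n : ℝ)) * ∑ i, h k (z i)
          = ∫ z', (1 / (n : ℝ)) * ∑ i, (h k (z' i) - h k (z i)) ∂π := by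
        rw [integral_const_mul, integral_finsetSum _ fun i _ => hid i]
        have : ∀ i : Fin n, ∫ z', (h k (z' i) - h k (z i)) ∂π = (∫ u, h k u ∂μ) - h k (z i) :=
          fun i => by
          rw [integral_sub (hik i) (integrable_const _)]
          have mp := measurePreserving_eval (fun _ : Fin n => μ) i
          have : ∫ z', h k (z' i) ∂π = ∫ u, h k u ∂μ := by
            rw [← mp.map_eq, integral_map mp.measurable.aemeasurable (hm k).aestronglyMeasurable]
          simp [this]
        simp only [this, Finset.sum_sub_distrib, Finset.sum_const, Finset.card_univ,
          Fintype.card_fin, nsmul_eq_mul]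
        field_simp
      rw [e2]
      refine integral_mono ((integrable_finsetSum _ fun i _ => hid i).const_mul _) ?_ fun z' => ?_
      · exact Integrable.of_bound (hSm'.comp measurable_prodMk_left).aestronglyMeasurable _
          (Eventually.of_forall fun z' => hSb _ _)
      · have := le_ciSup (bddAbove_range_of_abs_le fun k =>
          hterm (fun _ => true) k fun i => (z i, z' i)) k
        simpa [hS] using this
  -- exchanging the two samples in some of the coordinates
  have swap : ∀ s, ∫ w, S s w ∂ρ = ∫ w, S (fun _ => true) w ∂ρ := fun s => by
    have mp : MeasurePreserving
        (fun (w : Fin n → Z × Z) i => (if s i then id else Prod.swap : Z × Z → Z × Z) (w i)) ρ ρ := by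
      refine measurePreserving_pi _ _ fun i => ?_
      cases s i
      · simpa using Measure.measurePreserving_swap
      · simpa using MeasurePreserving.id _
    have e : S s = fun w => S (fun _ => true)
        (fun i => (if s i then id else Prod.swap : Z × Z → Z × Z) (w i)) := by
      funext w
      simp only [hS]
      congr 1; funext k; congr 1
      refine Finset.sum_congr rfl fun i _ => ?_
      cases s i <;> simp
    rw [e, ← integral_map mp.measurable.aemeasurable (hSm _).aestronglyMeasurable, mp.map_eq]
  have hRm := measurable_empRademacher_range (n := n) hm
  have hRi : Integrable (fun z : Fin n → Z => empRademacher (Set.range h) z) π :=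
    Integrable.of_bound hRm.aestronglyMeasurable _
      (Eventually.of_forall fun z => abs_empRademacher_range_le fun k i => hM k (z i))
  have mp1 : MeasurePreserving (fun (w : Fin n → Z × Z) i => (w i).1) ρ π :=
    measurePreserving_pi _ _ fun i => measurePreserving_fst
  have mp2 : MeasurePreserving (fun (w : Fin n → Z × Z) i => (w i).2) ρ π :=
    measurePreserving_pi _ _ fun i => measurePreserving_snd
  have hR2 : Integrable (fun w : Fin n → Z × Z =>
      empRademacher (Set.range h) fun i => (w i).2) ρ := mp2.integrable_comp_of_integrable hRi
  have hR1 : Integrable (fun w : Fin n → Z × Z =>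
      empRademacher (Set.range h) fun i => (w i).1) ρ := mp1.integrable_comp_of_integrable hRi
  have split : ∀ w, (1 / (2 : ℝ) ^ n) * ∑ s, S s w
      ≤ empRademacher (Set.range h) (fun i => (w i).2)
        + empRademacher (Set.range h) (fun i => (w i).1) := fun w => by
    rw [empRademacher_range, empRademacher_range, ← mul_add]
    gcongr
    -- Flipping all signs in the second average absorbs the minus sign in front of the first sample.
    rw [← (Equiv.arrowCongr (Equiv.refl (Fin n)) Equiv.boolNot).sum_comp (fun s => ⨆ k,
      (1 / (n : ℝ)) * ∑ i, (if s i then (1 : ℝ) else -1) * h k (w i).1), ← Finset.sum_add_distrib]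
    refine Finset.sum_le_sum fun s _ => ciSup_le fun k => ?_
    have hb : ∀ (s : Fin n → Bool) (z : Fin n → Z), BddAbove (Set.range fun k =>
        (1 / (n : ℝ)) * ∑ i, (if s i then (1 : ℝ) else -1) * h k (z i)) := fun s z =>
      bddAbove_range_of_abs_le (B := 1 / (n : ℝ) * (n * M)) fun k => by
        rw [abs_mul, abs_of_nonneg (by positivity)]
        gcongr
        exact abs_sum_sign_mul_le s fun i => hM k (z i)
    refine le_trans (le_of_eq ?_) (add_le_add (le_ciSup (hb s fun i => (w i).2) k)
      (le_ciSup (hb _ fun i => (w i).1) k))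
    rw [← mul_add, ← Finset.sum_add_distrib]
    congr 1
    refine Finset.sum_congr rfl fun i _ => ?_
    cases hsi : s i <;> simp [hsi, Equiv.arrowCongr] <;> ring
  calc _ ≤ ∫ w, S (fun _ => true) w ∂ρ := ghost
    _ = ∫ w, (1 / (2 : ℝ) ^ n) * ∑ s, S s w ∂ρ := by
      rw [integral_const_mul, integral_finsetSum _ fun s _ => hSi s]
      simp [swap]
    _ ≤ ∫ w, (empRademacher (Set.range h) (fun i => (w i).2)
        + empRademacher (Set.range h) (fun i => (w i).1)) ∂ρ :=
      integral_mono ((integrable_finsetSum _ fun s _ => hSi s).const_mul _)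
        (hR2.add hR1) split
    _ = 2 * ∫ z, empRademacher (Set.range h) z ∂π := by
      rw [integral_add hR2 hR1, two_mul]
      congr 1
      · rw [← mp2.map_eq, integral_map mp2.measurable.aemeasurable hRm.aestronglyMeasurable]
      · rw [← mp1.map_eq, integral_map mp1.measurable.aemeasurable hRm.aestronglyMeasurable]

end Symmetrization

/-! ### Empirical risk minimization -/

section ERM

/-- A family of continuous functions contains a sequence that is dense for pointwise convergence. -/
theorem exists_seq_pointwise_dense {S : Type*} [TopologicalSpace S] [SecondCountableTopology S]
    [LocallyCompactSpace S] {F : Set (S → ℝ)} (hF : F.Nonempty) (hc : ∀ f ∈ F, Continuous f) :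
    ∃ f : ℕ → S → ℝ, (∀ k, f k ∈ F) ∧
      ∀ g ∈ F, ∃ φ : ℕ → ℕ, ∀ s, Tendsto (fun j => f (φ j) s) atTop (𝓝 (g s)) := by
  -- The compact-open topology on `C(S, ℝ)` is second countable here, so every subset is separable,
  -- and evaluation at a point is continuous.
  set F' : Set C(S, ℝ) := {f | ⇑f ∈ F}
  have : Nonempty F' := let ⟨f, hf⟩ := hF; ⟨⟨⟨f, hc f hf⟩, hf⟩⟩
  obtain ⟨u, hu⟩ := TopologicalSpace.exists_dense_seq F'
  refine ⟨fun k => u k, fun k => (u k).2, fun g hg => ?_⟩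
  obtain ⟨v, hv, hlim⟩ := mem_closure_iff_seq_limit.1 (hu ⟨⟨g, hc g hg⟩, hg⟩)
  choose φ hφ using hv
  refine ⟨φ, fun s => ?_⟩
  have h1 : Tendsto (fun j => ((v j : F') : C(S, ℝ)) s) atTop (𝓝 (g s)) :=
    (((continuous_eval_const s).comp continuous_subtype_val).tendsto _).comp hlim
  simpa only [hφ] using h1

variable {S : Type*} {n : ℕ} {F : Set (S → ℝ)} {f : ℕ → S → ℝ}

/-- For fixed signs the signed mean depends on finitely many values, hence is continuous for
pointwise convergence and has the same supremum over the dense sequence. -/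
theorem empRademacher_eq_range (hf : ∀ k, f k ∈ F)
    (hdense : ∀ g ∈ F, ∃ φ : ℕ → ℕ, ∀ s, Tendsto (fun j => f (φ j) s) atTop (𝓝 (g s)))
    {ξ : Fin n → S} {B : ℝ} (hB : ∀ i, ∀ g ∈ F, |g (ξ i)| ≤ B) :
    empRademacher F ξ = empRademacher (Set.range f) ξ := by
  rw [empRademacher_range, empRademacher]
  congr 1
  refine Finset.sum_congr rfl fun s _ => ?_
  have : Nonempty F := ⟨⟨f 0, hf 0⟩⟩
  have hb : ∀ g ∈ F, |(1 / (n : ℝ)) * ∑ i, (if s i then (1 : ℝ) else -1) * g (ξ i)|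
      ≤ 1 / (n : ℝ) * (n * B) := fun g hg => by
    rw [abs_mul, abs_of_nonneg (by positivity)]
    gcongr
    exact abs_sum_sign_mul_le s fun i => hB i g hg
  refine le_antisymm (ciSup_le fun g => ?_) (ciSup_le fun k => ?_)
  · obtain ⟨φ, hφ⟩ := hdense g g.2
    refine le_of_tendsto' (((tendsto_finsetSum Finset.univ fun i _ =>
      (hφ (ξ i)).const_mul (if s i then (1 : ℝ) else -1))).const_mul (1 / (n : ℝ))) fun j => ?_
    exact le_ciSup (f := fun k => (1 / (n : ℝ)) *
      ∑ i, (if s i then (1 : ℝ) else -1) * f k (ξ i))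
      (bddAbove_range_of_abs_le fun k => hb _ (hf k)) (φ j)
  · exact le_ciSup (f := fun g : F => (1 / (n : ℝ)) *
      ∑ i, (if s i then (1 : ℝ) else -1) * (g : S → ℝ) (ξ i))
      (bddAbove_range_of_abs_le fun g => hb _ g.2) ⟨f k, hf k⟩

theorem empRademacher_nonneg (h0 : (fun _ => 0) ∈ F) (ξ : Fin n → S) : 0 ≤ empRademacher F ξ := by
  refine mul_nonneg (by positivity) (Finset.sum_nonneg fun s _ => ?_)
  by_cases hb : BddAbove (Set.range fun f : F => (1 / (n : ℝ)) *
      ∑ i, (if s i then (1 : ℝ) else -1) * (f : S → ℝ) (ξ i))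
  · exact le_trans (by simp) (le_ciSup hb ⟨fun _ => 0, h0⟩)
  · exact (Real.iSup_of_not_bddAbove hb).ge

/-- The expected risk of an empirical risk minimizer exceeds the risk of any member of the class by
at most `2 L` times the Rademacher complexity, for a loss that is `L`-Lipschitz in the prediction. -/
theorem integral_risk_le_of_isERM [TopologicalSpace S] [MeasurableSpace S] [BorelSpace S]
    [SecondCountableTopology S] [LocallyCompactSpace S] (hn : 1 ≤ n)
    (hc : ∀ f ∈ F, Continuous f) {𝒴 : Set ℝ} (h𝒴 : MeasurableSet 𝒴) {ℓ : ℝ → ℝ → ℝ}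
    (hℓ_meas : Measurable (Function.uncurry ℓ)) (hℓ_nonneg : ∀ y u, 0 ≤ ℓ y u) {L : ℝ} (hL : 0 ≤ L)
    (hℓ_lip : ∀ y ∈ 𝒴, ∀ u ∈ 𝒴, ∀ u' ∈ 𝒴, |ℓ y u - ℓ y u'| ≤ L * |u - u'|) {M : ℝ}
    (hℓ_bdd : ∀ y ∈ 𝒴, ∀ u ∈ 𝒴, ℓ y u ≤ M) {W : Type*} [MeasurableSpace W] {P : Measure W}
    [IsProbabilityMeasure P] {ξ : W → S} {y : W → ℝ} {B : ℝ}
    (hξ : ∀ᵐ ω ∂P, ∀ f ∈ F, f (ξ ω) ∈ 𝒴 ∧ |f (ξ ω)| ≤ B) (hy : ∀ᵐ ω ∂P, y ω ∈ 𝒴)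
    {Ξ : Fin n → W → S} {Y : Fin n → W → ℝ}
    (hΞ : ∀ i, ∀ᵐ ω ∂P, ∀ f ∈ F, f (Ξ i ω) ∈ 𝒴 ∧ |f (Ξ i ω)| ≤ B)
    (hident : ∀ i, IdentDistrib (fun ω => (Ξ i ω, Y i ω)) (fun ω => (ξ ω, y ω)) P P)
    (hindep : iIndepFun (fun i ω => (Ξ i ω, Y i ω)) P) {fhat : W → S → ℝ}
    (hfhat : ∀ᵐ ω ∂P, IsERM F ℓ (fun i => Ξ i ω) (fun i => Y i ω) (fhat ω))
    (hfhat_meas : AEMeasurable (fun ω => risk P ℓ ξ y (fhat ω)) P) {g : S → ℝ} (hg : g ∈ F) :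
    ∫ ω, risk P ℓ ξ y (fhat ω) ∂P ≤ risk P ℓ ξ y g + 2 * (L * rademacher P F Ξ) := by
  obtain ⟨f, hf, hdense⟩ := exists_seq_pointwise_dense ⟨g, hg⟩ hc
  set M' := max M 0 with hM'
  have hM'0 : 0 ≤ M' := le_max_right _ _
  -- Symmetrization needs functions bounded everywhere, whereas the loss is bounded only on `𝒴`. The
  -- truncation is almost surely inactive.
  set h : ℕ → S × ℝ → ℝ := fun k w => min (ℓ w.2 (f k w.1)) M' with hh
  have hcomp : ∀ f' ∈ F, Measurable fun w : S × ℝ => ℓ w.2 (f' w.1) := fun f' hf' =>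
    hℓ_meas.comp (measurable_snd.prodMk ((hc f' hf').measurable.comp measurable_fst))
  have hhm : ∀ k, Measurable (h k) := fun k => (hcomp _ (hf k)).min measurable_const
  have hhM : ∀ k w, |h k w| ≤ M' := fun k w =>
    abs_le.2 ⟨(neg_nonpos.2 hM'0).trans (le_min (hℓ_nonneg _ _) hM'0), min_le_right _ _⟩
  have hsmp := (hident ⟨0, hn⟩).aemeasurable_snd
  set μ : Measure (S × ℝ) := P.map fun ω => (ξ ω, y ω) with hμ
  have : IsProbabilityMeasure μ := Measure.isProbabilityMeasure_map hsmp
  have hZi : ∀ i, AEMeasurable (fun ω => (Ξ i ω, Y i ω)) P := fun i => (hident i).aemeasurable_fst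
  have hZ : AEMeasurable (fun ω i => (Ξ i ω, Y i ω)) P := aemeasurable_pi_lambda _ hZi
  have hlaw : P.map (fun ω i => (Ξ i ω, Y i ω)) = Measure.pi fun _ => μ := by
    rw [(iIndepFun_iff_map_fun_eq_pi_map hZi).1 hindep]
    congr 1; funext i; exact (hident i).map_eq
  -- points at which the loss is bounded and Lipschitz
  have hY : ∀ i, ∀ᵐ ω ∂P, Y i ω ∈ 𝒴 := fun i =>
    ((hident i).comp measurable_snd).symm.ae_mem_snd h𝒴 hy
  have hgood : ∀ᵐ ω ∂P, ∀ i, Y i ω ∈ 𝒴 ∧ ∀ f ∈ F, f (Ξ i ω) ∈ 𝒴 ∧ |f (Ξ i ω)| ≤ B :=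
    ae_all_iff.2 fun i => (hY i).and (hΞ i)
  have hbdd : ∀ᵐ ω ∂P, ∀ f ∈ F, |ℓ (y ω) (f (ξ ω))| ≤ M' := by
    filter_upwards [hξ, hy] with ω h1 h2 f' hf'
    rw [abs_of_nonneg (hℓ_nonneg _ _)]
    exact (hℓ_bdd _ h2 _ (h1 f' hf').1).trans (le_max_left _ _)
  have hmeas : ∀ f' ∈ F, AEStronglyMeasurable (fun ω => ℓ (y ω) (f' (ξ ω))) P := fun f' hf' =>
    ((hcomp f' hf').comp_aemeasurable hsmp).aestronglyMeasurable
  have hrisk_h : ∀ k, ∫ w, h k w ∂μ = risk P ℓ ξ y (f k) := fun k => by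
    rw [hμ, integral_map hsmp (hhm k).aestronglyMeasurable]
    refine integral_congr_ae ?_
    filter_upwards [hbdd] with ω h1
    exact min_eq_left ((le_abs_self _).trans (h1 _ (hf k)))
  have hemp_h : ∀ᵐ ω ∂P, ∀ k, (1 / (n : ℝ)) * ∑ i, h k (Ξ i ω, Y i ω)
      = empRisk ℓ (fun i => Ξ i ω) (fun i => Y i ω) (f k) := by
    filter_upwards [hgood] with ω h1 k
    rw [empRisk]
    congr 1
    refine Finset.sum_congr rfl fun i _ => min_eq_left ?_
    exact (hℓ_bdd _ (h1 i).1 _ ((h1 i).2 _ (hf k)).1).trans (le_max_left _ _)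
  -- the uniform deviation over the dense sequence dominates the one of every member of the class
  set T : (Fin n → S × ℝ) → ℝ := fun z =>
    ⨆ k, ((∫ w, h k w ∂μ) - (1 / (n : ℝ)) * ∑ i, h k (z i)) with hT
  have hTterm : ∀ (z : Fin n → S × ℝ) k, |(∫ w, h k w ∂μ) - (1 / (n : ℝ)) * ∑ i, h k (z i)|
      ≤ M' + 1 / (n : ℝ) * (n * M') := fun z k => by
    refine (abs_sub _ _).trans (add_le_add ?_ ?_)
    · simpa using norm_integral_le_of_norm_le_const (μ := μ) (f := h k)
        (Eventually.of_forall (hhM k))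
    · rw [abs_mul, abs_of_nonneg (by positivity)]
      gcongr
      simpa using abs_sum_sign_mul_le (fun _ : Fin n => true) fun i => hhM k (z i)
  have hTm : Measurable T := Measurable.iSup fun k => by
    have := hhm k
    fun_prop
  have hdev : ∀ᵐ ω ∂P, ∀ f' ∈ F, risk P ℓ ξ y f'
      - empRisk ℓ (fun i => Ξ i ω) (fun i => Y i ω) f' ≤ T fun i => (Ξ i ω, Y i ω) := by
    filter_upwards [hgood, hemp_h] with ω h1 h2 f' hf'
    obtain ⟨φ, hφ⟩ := hdense f' hf'
    have hloss : ∀ (s : S) (u : ℝ), u ∈ 𝒴 → (∀ f ∈ F, f s ∈ 𝒴 ∧ |f s| ≤ B) →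
        Tendsto (fun j => ℓ u (f (φ j) s)) atTop (𝓝 (ℓ u (f' s))) := fun s u hu hs => by
      have h3 : Tendsto (fun j => L * |f (φ j) s - f' s|) atTop (𝓝 0) := by
        simpa using (((hφ s).sub_const (f' s)).abs).const_mul L
      exact tendsto_iff_dist_tendsto_zero.2 (squeeze_zero (fun _ => dist_nonneg) (fun j =>
        hℓ_lip u hu _ (hs _ (hf _)).1 _ (hs _ hf').1) h3)
    have t1 : Tendsto (fun j => risk P ℓ ξ y (f (φ j))) atTop (𝓝 (risk P ℓ ξ y f')) := by
      refine tendsto_integral_of_dominated_convergence (fun _ => M')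
        (fun j => hmeas _ (hf _)) (integrable_const _) (fun j => ?_) ?_
      · filter_upwards [hbdd] with ω' h3
        exact h3 _ (hf _)
      · filter_upwards [hξ, hy] with ω' h3 h4
        exact hloss _ _ h4 h3
    have t2 : Tendsto (fun j => empRisk ℓ (fun i => Ξ i ω) (fun i => Y i ω) (f (φ j))) atTop
        (𝓝 (empRisk ℓ (fun i => Ξ i ω) (fun i => Y i ω) f')) :=
      (tendsto_finsetSum _ fun i _ => hloss _ _ (h1 i).1 (h1 i).2).const_mul _
    refine le_of_tendsto' (t1.sub t2) fun j => ?_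
    rw [← h2, ← hrisk_h]
    exact le_ciSup (f := fun k => (∫ w, h k w ∂μ) - (1 / (n : ℝ)) * ∑ i, h k (Ξ i ω, Y i ω))
      (bddAbove_range_of_abs_le fun k => hTterm (fun i => (Ξ i ω, Y i ω)) k) (φ j)
  have hTi : Integrable (fun ω => T fun i => (Ξ i ω, Y i ω)) P :=
    Integrable.of_bound (hTm.comp_aemeasurable hZ).aestronglyMeasurable _
      (Eventually.of_forall fun ω => abs_ciSup_le fun k => hTterm _ k)
  -- symmetrization and contraction
  have hsymm : ∫ ω, T (fun i => (Ξ i ω, Y i ω)) ∂P ≤ 2 * (L * rademacher P F Ξ) := by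
    have e1 : ∫ ω, T (fun i => (Ξ i ω, Y i ω)) ∂P = ∫ z, T z ∂(Measure.pi fun _ => μ) := by
      rw [← hlaw, integral_map hZ hTm.aestronglyMeasurable]
    have hRm := measurable_empRademacher_range (n := n) hhm
    have e2 : ∫ z : Fin n → S × ℝ, empRademacher (Set.range h) z ∂(Measure.pi fun _ => μ)
        = ∫ ω, empRademacher (Set.range h) (fun i => (Ξ i ω, Y i ω)) ∂P := by
      rw [← hlaw, integral_map hZ hRm.aestronglyMeasurable]
    rw [e1]
    refine (integral_ciSup_sub_le hn μ hhm hhM).trans ?_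
    rw [e2, rademacher, ← integral_const_mul L]
    have hFf : ∀ᵐ ω ∂P, empRademacher F (fun i => Ξ i ω)
        = empRademacher (Set.range f) (fun i => Ξ i ω) := by
      filter_upwards [hgood] with ω h1
      exact empRademacher_eq_range hf hdense fun i f' hf' => ((h1 i).2 f' hf').2
    have hFm : AEMeasurable (fun ω => empRademacher F (fun i => Ξ i ω)) P :=
      ((measurable_empRademacher_range fun k => (hc _ (hf k)).measurable).comp_aemeasurable
        (aemeasurable_pi_lambda _ fun i => measurable_fst.comp_aemeasurable (hZi i))).congr
        (hFf.mono fun ω h1 => h1.symm)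
    have hFi : Integrable (fun ω => empRademacher F (fun i => Ξ i ω)) P := by
      refine Integrable.of_bound hFm.aestronglyMeasurable (1 / (n : ℝ) * (n * B)) ?_
      filter_upwards [hgood, hFf] with ω h1 h2
      rw [h2]
      exact abs_empRademacher_range_le fun k i => ((h1 i).2 _ (hf k)).2
    have hRi : Integrable (fun ω => empRademacher (Set.range h) (fun i => (Ξ i ω, Y i ω))) P :=
      Integrable.of_bound (hRm.comp_aemeasurable hZ).aestronglyMeasurable _
        (Eventually.of_forall fun ω => abs_empRademacher_range_le fun k i => hhM k _)
    refine mul_le_mul_of_nonneg_left (integral_mono_ae hRi (hFi.const_mul L) ?_) zero_le_two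
    filter_upwards [hgood, hFf] with ω h1 h2
    change _ ≤ L * empRademacher F fun i => Ξ i ω
    rw [h2]
    refine empRademacher_range_le_mul h f _ _ (B := max M' B) hL
      (fun k i => (hhM k _).trans (le_max_left _ _))
      (fun k i => ((h1 i).2 _ (hf k)).2.trans (le_max_right _ _)) fun k l i => ?_
    have hmin : ∀ k, h k (Ξ i ω, Y i ω) = ℓ (Y i ω) (f k (Ξ i ω)) := fun k =>
      min_eq_left ((hℓ_bdd _ (h1 i).1 _ ((h1 i).2 _ (hf k)).1).trans (le_max_left _ _))
    rw [hmin, hmin]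
    exact hℓ_lip _ (h1 i).1 _ ((h1 i).2 _ (hf k)).1 _ ((h1 i).2 _ (hf l)).1
  -- the error decomposition
  have hgi : Integrable (fun ω => empRisk ℓ (fun i => Ξ i ω) (fun i => Y i ω) g) P ∧
      ∫ ω, empRisk ℓ (fun i => Ξ i ω) (fun i => Y i ω) g ∂P = risk P ℓ ξ y g := by
    have hid : ∀ i, IdentDistrib (fun ω => ℓ (Y i ω) (g (Ξ i ω))) (fun ω => ℓ (y ω) (g (ξ ω))) P P :=
      fun i => (hident i).comp (hcomp g hg)
    have hint : Integrable (fun ω => ℓ (y ω) (g (ξ ω))) P :=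
      Integrable.of_bound (hmeas g hg) M' (hbdd.mono fun ω h1 => h1 g hg)
    have hinti : ∀ i, Integrable (fun ω => ℓ (Y i ω) (g (Ξ i ω))) P := fun i =>
      (hid i).symm.integrable_snd hint
    refine ⟨(integrable_finsetSum _ fun i _ => hinti i).const_mul _, ?_⟩
    simp only [empRisk]
    rw [integral_const_mul, integral_finsetSum _ fun i _ => hinti i]
    have : ∀ i, ∫ ω, ℓ (Y i ω) (g (Ξ i ω)) ∂P = risk P ℓ ξ y g := fun i => (hid i).integral_eq
    simp only [this, Finset.sum_const, Finset.card_univ, Fintype.card_fin, nsmul_eq_mul]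
    have : (n : ℝ) ≠ 0 := by positivity
    field_simp
  have hfi : Integrable (fun ω => risk P ℓ ξ y (fhat ω)) P := by
    refine Integrable.of_bound hfhat_meas.aestronglyMeasurable M' ?_
    filter_upwards [hfhat] with ω h1
    have := norm_integral_le_of_norm_le_const (μ := P) (f := fun ω' => ℓ (y ω') (fhat ω (ξ ω')))
      (hbdd.mono fun ω' h2 => h2 _ h1.1)
    simpa [risk] using this
  -- Only the random `fhat` needs the uniform deviation `T`; for the fixed `g` empirical risk and
  -- risk have equal means. Hence the factor 2.
  calc ∫ ω, risk P ℓ ξ y (fhat ω) ∂P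
      ≤ ∫ ω, ((T fun i => (Ξ i ω, Y i ω)) + empRisk ℓ (fun i => Ξ i ω) (fun i => Y i ω) g) ∂P := by
        refine integral_mono_ae hfi (hTi.add hgi.1) ?_
        filter_upwards [hfhat, hdev] with ω h1 h2
        have h3 := h2 _ h1.1
        have h4 := h1.2 g hg
        change _ ≤ _ + _
        linarith
    _ = (∫ ω, T (fun i => (Ξ i ω, Y i ω)) ∂P) + risk P ℓ ξ y g := by
        rw [integral_add hTi hgi.1, hgi.2]
    _ ≤ _ := by linarith

end ERM

/-! ### The bias of the sampled model -/

section Bias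

variable {p d q K : ℕ} {c : Consts} {σ : ℝ → ℝ}

theorem measurable_sampleOn (D : Fin (K + 1) → unitInterval) :
    Measurable (sampleOn D : DrivingPath d → Series d K) :=
  measurable_pi_lambda _ fun k => measurable_pi_apply (D k)

theorem mesh_nonneg {D : Fin (K + 1) → unitInterval} (hD : IsGrid D) : 0 ≤ mesh D :=
  Real.iSup_nonneg fun _ => sub_nonneg.2 (hD.1.monotone Fin.castSucc_lt_succ.le)

theorem continuous_neuralVF (hq : 1 ≤ q) (hL : 0 ≤ c.Lσ) (hBA : 0 ≤ c.BA)
    (hσ : ∀ u v : ℝ, |σ u - σ v| ≤ c.Lσ * |u - v|) {ψ : VFParams p d q} (hψ : ψ ∈ psiSet p d q c) :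
    Continuous (neuralVF σ ψ) := by
  have h0 : 0 ≤ c.LG q := pow_nonneg (mul_nonneg hL hBA) q
  refine (LipschitzWith.of_dist_le_mul (K := NNReal.mk (c.LG q) h0) fun u v => ?_).continuous
  rw [dist_eq_norm, dist_eq_norm]
  exact norm_neuralVF_sub_le hq hL hBA hσ hψ u v

/-- Domination by a continuous `g` makes the real supremum meaningful; for `opNorm` the Frobenius
norm plays the role of `g`. -/
theorem le_ciSup_closedBall {E : Type*} [NormedAddCommGroup E] [ProperSpace E] {f g : E → ℝ}
    {r : ℝ} (hg : Continuous g) (hfg : ∀ u, f u ≤ g u) {u : E} (hu : ‖u‖ ≤ r) :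
    f u ≤ ⨆ w : Metric.closedBall (0 : E) r, f w := by
  obtain ⟨C, hC⟩ := (isCompact_closedBall (0 : E) r).bddAbove_image hg.continuousOn
  refine le_ciSup (f := fun w : Metric.closedBall (0 : E) r => f w) ?_ ⟨u, by simpa using hu⟩
  exact ⟨C, Set.forall_mem_range.2 fun w => (hfg w).trans (hC ⟨w, w.2, rfl⟩)⟩

theorem Consts.kappa_nonneg (hL : 0 ≤ c.Lσ) (hBA : 0 ≤ c.BA) (hBb : 0 ≤ c.Bb) (q : ℕ) :
    0 ≤ c.kappa q := by
  unfold Consts.kappa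
  positivity

/-- Both `M / BΦ` and `MD / BΦ` arise from the left side by adding a nonnegative term and
multiplying by a factor at least one. The error estimate needs only a bound on the initial value. -/
theorem initNN_bound_le_min (hL : 0 ≤ c.Lσ) (hLx : 0 ≤ c.Lx) (hBx : 0 ≤ c.Bx) (hBΦ : 0 < c.BΦ)
    (hBA : 0 ≤ c.BA) (hBb : 0 ≤ c.Bb) (hBU : 0 ≤ c.BU) (hBv : 0 ≤ c.Bv)
    {D : Fin (K + 1) → unitInterval} (hD : IsGrid D) :
    c.Lσ * (c.BU * c.Bx + c.Bv) ≤ min (c.MD q D) (c.M q) / c.BΦ := by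
  have hκ := Consts.kappa_nonneg hL hBA hBb q
  have hLGq : 0 ≤ c.LG q := pow_nonneg (mul_nonneg hL hBA) q
  have hm := mesh_nonneg hD
  have key : ∀ e : ℝ, 1 ≤ e → c.Lσ * (c.BU * c.Bx + c.Bv) * c.BΦ
      ≤ c.BΦ * c.Lσ * e * (c.BU * c.Bx + c.Bv + c.kappa q * c.Lx) := fun e he => by
    calc _ = c.BΦ * c.Lσ * 1 * (c.BU * c.Bx + c.Bv) := by ring
      _ ≤ _ := mul_le_mul (by gcongr) (le_add_of_nonneg_right (by positivity)) (by positivity)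
        (by positivity)
  rw [le_div_iff₀ hBΦ]
  exact le_min (key _ (one_le_pow₀ (le_add_of_nonneg_right (by positivity))))
    (key _ (Real.one_le_exp (by positivity)))

/-- The distance between a controlled ResNet on a sampled path and the target predictor with the
same readout: a discretization error and an approximation error. -/
theorem abs_ncdeD_sub_cdePredictor_le (hq : 1 ≤ q) (hL : 0 ≤ c.Lσ) (hLx : 0 ≤ c.Lx)
    (hBx : 0 ≤ c.Bx) (hBΦ : 0 < c.BΦ) (hBA : 0 ≤ c.BA) (hBb : 0 ≤ c.Bb) (hBU : 0 ≤ c.BU)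
    (hBv : 0 ≤ c.Bv) (hσ : ∀ u v : ℝ, |σ u - σ v| ≤ c.Lσ * |u - v|) (hσ0 : σ 0 = 0)
    {D : Fin (K + 1) → unitInterval} (hD : IsGrid D)
    {Gstar : Vec p → Matrix (Fin p) (Fin d) ℝ} {LG : ℝ} (hLG : 0 ≤ LG)
    (hGstar : ∀ z w : Vec p, ‖Gstar z - Gstar w‖ ≤ LG * ‖z - w‖)
    {φstar : Vec d → Vec p} (hφstar : Continuous φstar) {Φ : Vec p} (hΦ : ‖Φ‖ ≤ c.BΦ)
    {ψ : VFParams p d q} (hψ : ψ ∈ psiSet p d q c) {U : Matrix (Fin p) (Fin d) ℝ} {v : Vec p}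
    (hUv : (U, v) ∈ initSet p d c) {w : DrivingPath d} (hw : Admissible c w) :
    |ncdeD σ ⟨Φ, ψ, U, v⟩ (sampleOn D w) - cdePredictor Φ Gstar φstar w|
      ≤ c.BΦ * Real.exp (c.LG q * c.Lx) * c.Lx
          * (1 + c.LG q * (c.LG q * (min (c.MD q D) (c.M q) / c.BΦ) + c.kappa q) * c.Lx) * mesh D
        + c.BΦ * Real.exp (LG * c.Lx)
          * (c.Lx * (⨆ u : Metric.closedBall (0 : Vec p) (c.radius q),
              opNorm (neuralVF σ ψ (u : Vec p) - Gstar (u : Vec p)))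
            + ⨆ u : Metric.closedBall (0 : Vec d) c.Bx,
              ‖φstar (u : Vec d) - initNN σ U v (u : Vec d)‖) := by
  have hLGq : 0 ≤ c.LG q := pow_nonneg (mul_nonneg hL hBA) q
  have hκ := Consts.kappa_nonneg hL hBA hBb q
  have hm := mesh_nonneg hD
  have hG := norm_neuralVF_sub_le hq hL hBA hσ hψ
  have hGc := continuous_neuralVF hq hL hBA hσ hψ
  have hG0 : opNorm (neuralVF σ ψ 0) ≤ c.kappa q :=
    (opNorm_le_norm _).trans (norm_neuralVF_zero_le hq hL hBA hσ hσ0 hψ)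
  set z₀ := initNN σ U v (w 0) with hz₀
  have hz₀b : ‖z₀‖ ≤ c.Lσ * (c.BU * c.Bx + c.Bv) := norm_initNN_le hL hBU hσ hσ0 hUv hw.2
  obtain ⟨z, hz, -⟩ := exists_isCDESolution_cdeTerminal_eq hLGq hLx hG hw.1 z₀
  obtain ⟨zs, hzs, hzs1⟩ := exists_isCDESolution_cdeTerminal_eq hLG hLx hGstar hw.1 (φstar (w 0))
  have hGz₀ : opNorm (neuralVF σ ψ z₀)
      ≤ c.LG q * (min (c.MD q D) (c.M q) / c.BΦ) + c.kappa q := by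
    have h1 := opNorm_le_add hG z₀ 0
    have h2 := hz₀b.trans (initNN_bound_le_min (q := q) hL hLx hBx hBΦ hBA hBb hBU hBv hD)
    rw [sub_zero] at h1
    have h3 := mul_le_mul_of_nonneg_left h2 hLGq
    linarith
  have hdisc := hz.norm_sub_resnetTerminal_le hLGq hLx hG hw.1 hD
  have hrad : ∀ t, ‖z t‖ ≤ c.radius q := fun t => by
    have h1 := hz.norm_le hLGq hLx hG hw.1 t
    have ht0 : (0 : ℝ) ≤ t := t.2.1
    have ht1 : (t : ℝ) ≤ 1 := t.2.2
    have := opNorm_nonneg (neuralVF σ ψ 0)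
    calc ‖z t‖ ≤ _ := h1
      _ ≤ Real.exp (c.LG q * c.Lx * 1) * (c.Lσ * (c.BU * c.Bx + c.Bv) + c.kappa q * c.Lx * 1) := by
        gcongr
      _ = c.radius q := by rw [Consts.radius]; ring_nf
  have hGsc : Continuous Gstar := by
    refine (LipschitzWith.of_dist_le_mul (K := NNReal.mk LG hLG) fun u v => ?_).continuous
    rw [dist_eq_norm, dist_eq_norm]
    exact hGstar u v
  set A := ⨆ u : Metric.closedBall (0 : Vec p) (c.radius q),
    opNorm (neuralVF σ ψ (u : Vec p) - Gstar (u : Vec p))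
  set I := ⨆ u : Metric.closedBall (0 : Vec d) c.Bx, ‖φstar (u : Vec d) - initNN σ U v (u : Vec d)‖
  have hA : ∀ t, opNorm (neuralVF σ ψ (z t) - Gstar (z t)) ≤ A := fun t =>
    le_ciSup_closedBall (f := fun u => opNorm (neuralVF σ ψ u - Gstar u)) (hGc.sub hGsc).norm
      (fun u => opNorm_le_norm _) (hrad t)
  have hI : ‖z₀ - φstar (w 0)‖ ≤ I := by
    rw [norm_sub_rev]
    exact le_ciSup_closedBall (f := fun u => ‖φstar u - initNN σ U v u‖)
      (hφstar.sub (continuous_initNN hL hσ U v)).norm (fun u => le_rfl) hw.2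
  have hstab := hz.norm_sub_le_of_opNorm_le hzs hLGq hLG hLx hG hGstar hw.1 hA
  have hinit : sampleOn D w 0 = w 0 := by rw [sampleOn, hD.2.1]
  set E₁ := Real.exp (c.LG q * c.Lx)
  set E₂ := Real.exp (LG * c.Lx)
  set R := c.LG q * (min (c.MD q D) (c.M q) / c.BΦ) + c.kappa q
  have hR0 : 0 ≤ R := (opNorm_nonneg _).trans hGz₀
  simp only [ncdeD, cdePredictor, hinit, hzs1]
  rw [← inner_sub_right, ← Real.norm_eq_abs]
  calc _ ≤ ‖Φ‖ * ‖resnetTerminal (neuralVF σ ψ) z₀ (sampleOn D w) - zs 1‖ := norm_inner_le_norm _ _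
    _ ≤ c.BΦ * (E₁ * (c.Lx * (1 + c.LG q * R * c.Lx) * mesh D) + E₂ * (c.Lx * A + I)) := by
      gcongr
      -- The intermediate point is the neural CDE driven by the unsampled path.
      refine (norm_sub_le_norm_sub_add_norm_sub _ (z 1) _).trans (add_le_add ?_ ?_)
      · rw [norm_sub_rev]
        refine hdisc.trans (mul_le_mul_of_nonneg_left ?_ (Real.exp_nonneg _))
        calc _ ≤ c.LG q * c.Lx * c.Lx * mesh D * R := by gcongr
          -- The added term produces the `1` in the bracket of the stated bound; it is slack.
          _ ≤ c.LG q * c.Lx * c.Lx * mesh D * R + c.Lx * mesh D :=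
            le_add_of_nonneg_right (by positivity)
          _ = _ := by ring
      · refine hstab.trans (mul_le_mul_of_nonneg_left ?_ (Real.exp_nonneg _))
        linarith
    _ = _ := by ring

/-- Uniformity in `θ` keeps the suprema in the Rademacher complexity finite; the value of `B` does
not enter the final bound. -/
theorem exists_forall_abs_ncdeD_le (hq : 1 ≤ q) (hL : 0 ≤ c.Lσ) (hLx : 0 ≤ c.Lx)
    (hBΦ : 0 < c.BΦ) (hBA : 0 ≤ c.BA) (hBU : 0 ≤ c.BU)
    (hσ : ∀ u v : ℝ, |σ u - σ v| ≤ c.Lσ * |u - v|) (hσ0 : σ 0 = 0)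
    {D : Fin (K + 1) → unitInterval} (hD : IsGrid D) :
    ∃ B : ℝ, ∀ θ ∈ thetaSet p d q c, ∀ w : DrivingPath d, Admissible c w →
      |ncdeD σ θ (sampleOn D w)| ≤ B := by
  refine ⟨c.BΦ * (Real.exp (c.LG q * c.Lx) * (c.Lσ * (c.BU * c.Bx + c.Bv) + c.kappa q * c.Lx)
      + Real.exp (c.LG q * c.Lx) * (c.LG q * c.Lx * c.Lx * mesh D
        * (c.kappa q + c.LG q * (c.Lσ * (c.BU * c.Bx + c.Bv))))), fun θ hθ w hw => ?_⟩
  have hLGq : 0 ≤ c.LG q := pow_nonneg (mul_nonneg hL hBA) q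
  have hm := mesh_nonneg hD
  have hG := norm_neuralVF_sub_le hq hL hBA hσ hθ.2.1
  have hG0 : opNorm (neuralVF σ θ.ψ 0) ≤ c.kappa q :=
    (opNorm_le_norm _).trans (norm_neuralVF_zero_le hq hL hBA hσ hσ0 hθ.2.1)
  set z₀ := initNN σ θ.U θ.v (w 0) with hz₀
  have hz₀b : ‖z₀‖ ≤ c.Lσ * (c.BU * c.Bx + c.Bv) := norm_initNN_le hL hBU hσ hσ0 hθ.2.2 hw.2
  have hGz₀ : opNorm (neuralVF σ θ.ψ z₀)
      ≤ c.kappa q + c.LG q * (c.Lσ * (c.BU * c.Bx + c.Bv)) := by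
    have h1 := opNorm_le_add hG z₀ 0
    rw [sub_zero] at h1
    exact h1.trans (add_le_add hG0 (mul_le_mul_of_nonneg_left hz₀b hLGq))
  have hinit : sampleOn D w 0 = w 0 := by rw [sampleOn, hD.2.1]
  simp only [ncdeD, hinit]
  rw [← Real.norm_eq_abs]
  refine (norm_inner_le_norm _ _).trans (mul_le_mul hθ.1
    ((norm_resnetTerminal_le hLGq hLx hG hw.1 hD z₀).trans ?_) (norm_nonneg _) hBΦ.le)
  gcongr

theorem continuous_ncdeD (hq : 1 ≤ q) (hL : 0 ≤ c.Lσ) (hBA : 0 ≤ c.BA)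
    (hσ : ∀ u v : ℝ, |σ u - σ v| ≤ c.Lσ * |u - v|) {θ : Params p d q}
    (hθ : θ ∈ thetaSet p d q c) : Continuous (ncdeD σ θ : Series d K → ℝ) :=
  continuous_const.inner (continuous_resnetTerminal (pow_nonneg (mul_nonneg hL hBA) q)
    (norm_neuralVF_sub_le hq hL hBA hσ hθ.2.1) (continuous_initNN hL hσ θ.U θ.v))

/-- The equidistant grid. -/
noncomputable def uniformGrid (N : ℕ) (k : Fin (N + 1 + 1)) : unitInterval :=
  clampUnit ((k : ℕ) / ((N : ℝ) + 1))

theorem coe_uniformGrid (N : ℕ) (k : Fin (N + 1 + 1)) :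
    (uniformGrid N k : ℝ) = (k : ℕ) / ((N : ℝ) + 1) := by
  refine coe_clampUnit (by positivity) (div_le_one_of_le₀ ?_ (by positivity))
  exact_mod_cast Nat.lt_succ_iff.1 k.2

theorem isGrid_uniformGrid (N : ℕ) : IsGrid (uniformGrid N) := by
  refine ⟨fun i j hij => ?_, ?_, ?_⟩
  · rw [← Subtype.coe_lt_coe, coe_uniformGrid, coe_uniformGrid]
    have : ((i : ℕ) : ℝ) < (j : ℕ) := by exact_mod_cast hij
    gcongr
  · ext; simp [coe_uniformGrid]
  · ext
    rw [coe_uniformGrid, Fin.val_last]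
    push_cast
    rw [div_self (by positivity)]

theorem mesh_uniformGrid_le (N : ℕ) : mesh (uniformGrid N) ≤ 1 / ((N : ℝ) + 1) := by
  refine ciSup_le fun k => le_of_eq ?_
  rw [coe_uniformGrid, coe_uniformGrid, Fin.val_succ, Fin.val_castSucc]
  push_cast
  ring

/-- The target predictor of a random path is measurable, as a limit of Euler schemes. -/
theorem aemeasurable_cdePredictor (hLx : 0 ≤ c.Lx) {G : Vec p → Matrix (Fin p) (Fin d) ℝ} {L : ℝ}
    (hL : 0 ≤ L) (hG : ∀ z w : Vec p, ‖G z - G w‖ ≤ L * ‖z - w‖) {φ : Vec d → Vec p}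
    (hφ : Continuous φ) (Φ : Vec p) {W : Type*} [MeasurableSpace W] {P : Measure W}
    {x : W → DrivingPath d} (hxm : AEMeasurable x P) (hx : ∀ᵐ ω ∂P, Admissible c (x ω)) :
    AEMeasurable (fun ω => cdePredictor Φ G φ (x ω)) P := by
  have hinit : ∀ (N : ℕ) (w : DrivingPath d), sampleOn (uniformGrid N) w 0 = w 0 := fun N w => by
    rw [sampleOn, (isGrid_uniformGrid N).2.1]
  refine aemeasurable_of_tendsto_metrizable_ae atTop (f := fun (N : ℕ) ω =>
    inner ℝ Φ (resnetTerminal G (φ (sampleOn (uniformGrid N) (x ω) 0))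
      (sampleOn (uniformGrid N) (x ω)))) (fun N => ?_) ?_
  · have hc : Continuous fun s : Series d (N + 1) => inner ℝ Φ (resnetTerminal G (φ (s 0)) s) :=
      continuous_const.inner (continuous_resnetTerminal hL hG hφ)
    exact hc.measurable.comp_aemeasurable ((measurable_sampleOn _).comp_aemeasurable hxm)
  · filter_upwards [hx] with ω hω
    obtain ⟨z, hz, hz1⟩ := exists_isCDESolution_cdeTerminal_eq hL hLx hG hω.1 (φ (x ω 0))
    rw [cdePredictor, hz1]
    refine ((continuous_const (y := Φ)).inner continuous_id).continuousAt.tendsto.comp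
      (x := atTop) ?_
    simp only [hinit]
    rw [tendsto_iff_norm_sub_tendsto_zero]
    have hlim : Tendsto (fun N : ℕ => Real.exp (L * c.Lx) * (L * c.Lx * c.Lx * (1 / ((N : ℝ) + 1))
        * opNorm (G (φ (x ω 0))))) atTop (𝓝 0) := by
      have := ((tendsto_one_div_add_atTop_nhds_zero_nat (𝕜 := ℝ)).const_mul
        (L * c.Lx * c.Lx)).mul_const (opNorm (G (φ (x ω 0))))
      simpa using this.const_mul (Real.exp (L * c.Lx))
    refine squeeze_zero (fun _ => norm_nonneg _) (fun N => ?_) hlim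
    rw [norm_sub_rev]
    refine (hz.norm_sub_resnetTerminal_le hL hLx hG hω.1 (isGrid_uniformGrid N)).trans ?_
    have := opNorm_nonneg (G (φ (x ω 0)))
    gcongr
    exact mesh_uniformGrid_le N

theorem zero_mem_psiSet (hBA : 0 ≤ c.BA) (hBb : 0 ≤ c.Bb) :
    (⟨0, 0, 0, 0⟩ : VFParams p d q) ∈ psiSet p d q c :=
  ⟨fun _ => by simpa using hBA, fun _ => by simpa using hBb, by simpa using hBA, by simpa using hBb⟩

theorem zero_mem_initSet (hBU : 0 ≤ c.BU) (hBv : 0 ≤ c.Bv) :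
    (0 : Matrix (Fin p) (Fin d) ℝ × Vec p) ∈ initSet p d c :=
  ⟨by simpa using hBU, by simpa using hBv⟩

theorem zero_mem_classFD (hBΦ : 0 < c.BΦ) (hBA : 0 ≤ c.BA) (hBb : 0 ≤ c.Bb) (hBU : 0 ≤ c.BU)
    (hBv : 0 ≤ c.Bv) : (fun _ => 0) ∈ classFD p d q K σ c := by
  refine ⟨⟨0, ⟨0, 0, 0, 0⟩, 0, 0⟩, ⟨by simpa using hBΦ.le, zero_mem_psiSet hBA hBb,
    zero_mem_initSet hBU hBv⟩, ?_⟩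
  funext s
  simp [ncdeD]

end Bias

end NCDE

/-! ### The bound on the total risk -/

theorem theorem2 {p d q K n : ℕ} (hq : 1 ≤ q) (hn : 1 ≤ n)
    -- constants, activation function and sampling grid
    (c : Consts) (hLσ : 0 ≤ c.Lσ) (hLx : 0 ≤ c.Lx) (hBx : 0 ≤ c.Bx) (hBΦ : 0 < c.BΦ)
    (hBA : 0 ≤ c.BA) (hBb : 0 ≤ c.Bb) (hBU : 0 ≤ c.BU) (hBv : 0 ≤ c.Bv)
    (σ : ℝ → ℝ) (hσ : ∀ u v : ℝ, |σ u - σ v| ≤ c.Lσ * |u - v|) (hσ0 : σ 0 = 0)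
    (D : Fin (K + 1) → unitInterval) (hD : IsGrid D)
    -- the true vector field, initial map and readout
    (Gstar : Vec p → Matrix (Fin p) (Fin d) ℝ) (LG : ℝ) (hLG : 0 ≤ LG)
    (hGstar : ∀ z w : Vec p, ‖Gstar z - Gstar w‖ ≤ LG * ‖z - w‖)
    (φstar : Vec d → Vec p) (hφstar : Continuous φstar)
    (Φstar : Vec p) (hΦstar : ‖Φstar‖ ≤ c.BΦ)
    -- the loss, on a set of labels that contains the outcomes and the predictions
    (𝒴 : Set ℝ) (h𝒴 : MeasurableSet 𝒴)
    (h𝒴_star : ∀ w : DrivingPath d, Admissible c w → cdePredictor Φstar Gstar φstar w ∈ 𝒴)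
    (h𝒴_pred : ∀ θ ∈ thetaSet p d q c, ∀ w : DrivingPath d, Admissible c w →
      ncde σ θ w ∈ 𝒴 ∧ ncdeD σ θ (sampleOn D w) ∈ 𝒴)
    (ℓ : ℝ → ℝ → ℝ) (hℓ_meas : Measurable (Function.uncurry ℓ)) (hℓ_nonneg : ∀ y u, 0 ≤ ℓ y u)
    (Lℓ : ℝ) (hLℓ : 0 ≤ Lℓ)
    (hℓ_lip : ∀ y ∈ 𝒴, ∀ u ∈ 𝒴, ∀ u' ∈ 𝒴, |ℓ y u - ℓ y u'| ≤ Lℓ * |u - u'|)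
    (Mℓ : ℝ) (hℓ_bdd : ∀ y ∈ 𝒴, ∀ u ∈ 𝒴, ℓ y u ≤ Mℓ)
    -- the generic pair `(x, y)`, with `y` given by the well-specified model
    {W : Type*} [MeasurableSpace W] (P : Measure W) [IsProbabilityMeasure P]
    (x : W → DrivingPath d) (y ε : W → ℝ) (Mε : ℝ)
    (hx : ∀ᵐ ω ∂P, Admissible c (x ω))
    (hy : ∀ᵐ ω ∂P, y ω = cdePredictor Φstar Gstar φstar (x ω) + ε ω)
    (hε : ∀ᵐ ω ∂P, |ε ω| ≤ Mε)
    (hy𝒴 : ∀ᵐ ω ∂P, y ω ∈ 𝒴)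
    -- the i.i.d. sample
    (X : Fin n → W → DrivingPath d) (Y : Fin n → W → ℝ)
    (hX : ∀ i, ∀ᵐ ω ∂P, Admissible c (X i ω))
    (hident : ∀ i, IdentDistrib (fun ω => (X i ω, Y i ω)) (fun ω => (x ω, y ω)) P P)
    (hindep : iIndepFun (fun i ω => (X i ω, Y i ω)) P)
    -- the empirical risk minimizer on the sampled data
    (fhat : W → Series d K → ℝ)
    (hfhat : ∀ᵐ ω ∂P, IsERM (classFD p d q K σ c) ℓ (fun i => sampleOn D (X i ω))
      (fun i => Y i ω) (fhat ω))
    (hfhat_meas : AEMeasurable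
      (fun ω => risk P ℓ (fun ω' => sampleOn D (x ω')) y (fhat ω)) P) :
    (∫ ω, risk P ℓ (fun ω' => sampleOn D (x ω')) y (fhat ω) ∂P)
        - risk P ℓ x y (cdePredictor Φstar Gstar φstar)
      ≤ 4 * Lℓ * max (rademacher P (classF p d q σ c) X)
            (rademacher P (classFD p d q K σ c) (fun i ω => sampleOn D (X i ω)))
        + Lℓ * c.BΦ * Real.exp (c.LG q * c.Lx) * c.Lx
            * (1 + c.LG q * (c.LG q * (min (c.MD q D) (c.M q) / c.BΦ) + c.kappa q) * c.Lx)
            * mesh D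
        + Lℓ * c.BΦ * Real.exp (LG * c.Lx)
            * (c.Lx * (⨅ ψ : psiSet p d q c,
                  ⨆ u : Metric.closedBall (0 : Vec p) (c.radius q),
                    opNorm (neuralVF σ (ψ : VFParams p d q) (u : Vec p) - Gstar (u : Vec p)))
              + ⨅ ξ : initSet p d c,
                  ⨆ u : Metric.closedBall (0 : Vec d) c.Bx,
                    ‖φstar (u : Vec d)
                      - initNN σ (ξ : Matrix (Fin p) (Fin d) ℝ × Vec p).1
                          (ξ : Matrix (Fin p) (Fin d) ℝ × Vec p).2 (u : Vec d)‖) := by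
  have : Nonempty (psiSet p d q c) := ⟨⟨_, zero_mem_psiSet hBA hBb⟩⟩
  have : Nonempty (initSet p d c) := ⟨⟨_, zero_mem_initSet hBU hBv⟩⟩
  have hpair : Measurable fun w : DrivingPath d × ℝ => (sampleOn D w.1, w.2) :=
    ((measurable_sampleOn D).comp measurable_fst).prodMk measurable_snd
  have hxy := (hident ⟨0, hn⟩).aemeasurable_snd
  have hxm : AEMeasurable x P := measurable_fst.comp_aemeasurable hxy
  have hym : AEMeasurable y P := measurable_snd.comp_aemeasurable hxy
  obtain ⟨B, hB⟩ : ∃ B : ℝ, ∀ w : DrivingPath d, Admissible c w → ∀ f ∈ classFD p d q K σ c,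
      f (sampleOn D w) ∈ 𝒴 ∧ |f (sampleOn D w)| ≤ B := by
    obtain ⟨B, hB⟩ := exists_forall_abs_ncdeD_le (p := p) hq hLσ hLx hBΦ hBA hBU hσ hσ0 hD
    refine ⟨B, fun w hw => ?_⟩
    rintro _ ⟨θ, hθ, rfl⟩
    exact ⟨(h𝒴_pred θ hθ w hw).2, hB θ hθ w hw⟩
  have hF : ∀ f ∈ classFD p d q K σ c, Continuous f := by
    rintro _ ⟨θ, hθ, rfl⟩
    exact continuous_ncdeD hq hLσ hBA hσ hθ
  set RD := rademacher P (classFD p d q K σ c) (fun i ω => sampleOn D (X i ω)) with hRD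
  have hRD0 : 0 ≤ RD := integral_nonneg fun ω =>
    empRademacher_nonneg (zero_mem_classFD hBΦ hBA hBb hBU hBv) _
  set S : VFParams p d q → ℝ := fun ψ => ⨆ u : Metric.closedBall (0 : Vec p) (c.radius q),
    opNorm (neuralVF σ ψ (u : Vec p) - Gstar (u : Vec p)) with hS
  set T : Matrix (Fin p) (Fin d) ℝ × Vec p → ℝ := fun ξ => ⨆ u : Metric.closedBall (0 : Vec d) c.Bx,
    ‖φstar (u : Vec d) - initNN σ ξ.1 ξ.2 (u : Vec d)‖ with hT
  set C₁ := c.BΦ * Real.exp (c.LG q * c.Lx) * c.Lx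
    * (1 + c.LG q * (c.LG q * (min (c.MD q D) (c.M q) / c.BΦ) + c.kappa q) * c.Lx) * mesh D with hC₁
  set C₂ := c.BΦ * Real.exp (LG * c.Lx) with hC₂
  have hC₂0 : 0 ≤ C₂ := mul_nonneg hBΦ.le (Real.exp_nonneg _)
  have main : ∀ ψ ∈ psiSet p d q c, ∀ ξ ∈ initSet p d c,
      (∫ ω, risk P ℓ (fun ω' => sampleOn D (x ω')) y (fhat ω) ∂P)
        - risk P ℓ x y (cdePredictor Φstar Gstar φstar)
      ≤ 2 * (Lℓ * RD) + Lℓ * (C₁ + C₂ * (c.Lx * S ψ + T ξ)) := by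
    intro ψ hψ ξ hξ
    -- With the true readout, the comparison with the target involves only the latent states.
    set θ : Params p d q := ⟨Φstar, ψ, ξ.1, ξ.2⟩
    have hθ : θ ∈ thetaSet p d q c := ⟨hΦstar, hψ, hξ⟩
    have herm := integral_risk_le_of_isERM (F := classFD p d q K σ c)
      (ξ := fun ω => sampleOn D (x ω)) (Ξ := fun i ω => sampleOn D (X i ω)) (B := B) hn hF h𝒴
      hℓ_meas hℓ_nonneg hLℓ hℓ_lip hℓ_bdd (hx.mono fun ω hω => hB _ hω) hy𝒴
      (fun i => (hX i).mono fun ω hω => hB _ hω) (fun i => (hident i).comp hpair)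
      (hindep.comp (fun _ w => (sampleOn D w.1, w.2)) fun _ => hpair) hfhat hfhat_meas
      (g := ncdeD σ θ) ⟨θ, hθ, rfl⟩
    have hbd : ∀ {u : W → ℝ}, AEMeasurable u P → (∀ᵐ ω ∂P, u ω ∈ 𝒴) →
        Integrable (fun ω => ℓ (y ω) (u ω)) P := fun {u} hu hu𝒴 => by
      refine Integrable.of_bound (hℓ_meas.comp_aemeasurable (hym.prodMk hu)).aestronglyMeasurable
        Mℓ ?_
      filter_upwards [hy𝒴, hu𝒴] with ω h1 h2
      rw [Real.norm_eq_abs]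
      exact (abs_of_nonneg (hℓ_nonneg _ _)).trans_le (hℓ_bdd _ h1 _ h2)
    have i1 : Integrable (fun ω => ℓ (y ω) (ncdeD σ θ (sampleOn D (x ω)))) P :=
      hbd ((continuous_ncdeD hq hLσ hBA hσ hθ).measurable.comp_aemeasurable
        ((measurable_sampleOn D).comp_aemeasurable hxm))
        (hx.mono fun ω hω => (h𝒴_pred θ hθ _ hω).2)
    have i2 : Integrable (fun ω => ℓ (y ω) (cdePredictor Φstar Gstar φstar (x ω))) P :=
      hbd (aemeasurable_cdePredictor hLx hLG hGstar hφstar Φstar hxm hx)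
        (hx.mono fun ω hω => h𝒴_star _ hω)
    have hbias : risk P ℓ (fun ω => sampleOn D (x ω)) y (ncdeD σ θ)
        - risk P ℓ x y (cdePredictor Φstar Gstar φstar)
        ≤ Lℓ * (C₁ + C₂ * (c.Lx * S ψ + T ξ)) := by
      rw [risk, risk, ← integral_sub i1 i2]
      refine (integral_mono_ae (i1.sub i2)
        (integrable_const (Lℓ * (C₁ + C₂ * (c.Lx * S ψ + T ξ)))) ?_).trans (by simp)
      filter_upwards [hx, hy𝒴] with ω h1 h2
      refine (le_abs_self _).trans ((hℓ_lip _ h2 _ (h𝒴_pred θ hθ _ h1).2 _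
        (h𝒴_star _ h1)).trans (mul_le_mul_of_nonneg_left ?_ hLℓ))
      exact abs_ncdeD_sub_cdePredictor_le hq hLσ hLx hBx hBΦ hBA hBb hBU hBv hσ hσ0 hD hLG hGstar
        hφstar hΦstar hψ hξ h1
    linarith
  -- Nonnegativity of `RD` suffices; nothing about the complexity of the continuous class is used.
  have hmax : 2 * (Lℓ * RD) ≤ 4 * Lℓ * max (rademacher P (classF p d q σ c) X) RD := by
    have h1 := mul_le_mul_of_nonneg_left
      (le_max_right (rademacher P (classF p d q σ c) X) RD) hLℓ
    have h2 := mul_nonneg hLℓ hRD0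
    linarith
  have hinf : ∀ η : ℝ, 0 < η → (∫ ω, risk P ℓ (fun ω' => sampleOn D (x ω')) y (fhat ω) ∂P)
        - risk P ℓ x y (cdePredictor Φstar Gstar φstar)
      ≤ 2 * (Lℓ * RD) + Lℓ * (C₁ + C₂ * (c.Lx * ((⨅ ψ : psiSet p d q c, S ψ) + η)
        + ((⨅ ξ : initSet p d c, T ξ) + η))) := by
    intro η hη
    obtain ⟨ψ, hψ⟩ := exists_lt_of_ciInf_lt (lt_add_of_pos_right (⨅ ψ : psiSet p d q c, S ψ) hη)
    obtain ⟨ξ, hξ⟩ := exists_lt_of_ciInf_lt (lt_add_of_pos_right (⨅ ξ : initSet p d c, T ξ) hη)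
    refine (main ψ ψ.2 ξ ξ.2).trans ?_
    gcongr
  have hlim := ge_of_tendsto (x := nhdsWithin (0 : ℝ) (Set.Ioi 0))
    (((by fun_prop : Continuous fun η : ℝ => 2 * (Lℓ * RD) + Lℓ * (C₁ + C₂ * (c.Lx
      * ((⨅ ψ : psiSet p d q c, S ψ) + η) + ((⨅ ξ : initSet p d c, T ξ) + η)))).tendsto 0).mono_left
      nhdsWithin_le_nhds) (Filter.eventually_of_mem self_mem_nhdsWithin hinf)
  rw [add_zero, add_zero] at hlim
  refine hlim.trans ?_
  rw [hC₁, hC₂]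
  linarith
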